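/- Let $(\Omega,d,\mu)$ be a connected metric space with a Borel probability measure $\mu$ that is non-atomic and separable (i.e. concentrated on a separable subset). Notation. For a real function $u$ on a measure space $(X,\nu)$ put $\nu_u(t)=\nu\{|u|>t\}$, $u_\nu^*(s)=\inf\{t\ge 0:\nu_u(t)\le s\}$ and $u_\nu^{**}(t)=\frac1t\int_0^t u_\nu^*(s)\,ds$; write $f^*=f^*_\mu$, $f^{**}=f_\mu^{**}$ for functions on $\Omega$. For a Borel set $A\subset\Omega$ let $\mu^+(A)=\liminf_{h\to0+}\frac{\mu(A_h)-\mu(A)}{h}$, $A_h=\{x:d(x,A)<h\}$. The isoperimetric profile is $I_\mu(t)=\inf\{\mu^+(A): A \text{ Borel},\ \mu(A)=t\}$, $t\in[0,1]$. Let $\mathrm{Lip}(\Omega)$ be the set of functions $f:\Omega\to\mathbb R$ that are Lipschitz on every ball, and let $|\nabla f|(x)=\limsup_{y\to x,\,y\neq x}\frac{|f(x)-f(y)|}{d(x,y)}$ (zero at isolated points). Call a function $I:[0,1]\to[0,\infty)$ admissible if it is continuous, concave, (weakly) increasing on $(0,1/2)$, symmetric about $1/2$, with $I(0)=0$ and $I>0$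 on $(0,1)$. An isoperimetric estimator is an admissible $I$ with $I\le I_\mu$ on $[0,1]$. Standing assumptions: $I_\mu$ is finite and admissible; and for all $f\in\mathrm{Lip}(\Omega)$ and $c\in\mathbb R$, $|\nabla f|=0$ $\mu$-a.e. on $\{f=c\}$. Theorem. Let $I$ be admissible. Then the following five statements are equivalent, and if $I$ is an isoperimetric estimator, all of them hold. 1. (Isoperimetric inequality) $\mu^+(A)\ge I(\mu(A))$ for all Borel sets $A\subset\Omega$. 2. (Ledoux) $\int_0^\infty I(\mu_f(s))\,ds\le\int_\Omega|\nabla f|\,d\mu$ for all $f\in\mathrm{Lip}(\Omega)$. 3. (Maz'ya) For all $f\in\mathrm{Lip}(\Omega)$ and almost every $s\in(0,1)$, both derivatives below exist (the one on the right in $[0,\infty]$) and $$(-f^*)'(s)\,I(s)\le\frac{d}{ds}\int_{\{|f|>f^*(s)\}}|\nabla f|\,d\mu ,$$ where for $a\le b$ the increment from $a$ to $b$ of the function being differentiated on the right is taken to be $\int_{\{f^*(b)<|f|\le f^*(a)\}}|\nabla f|\,d\mu$ (this is the usual difference whenever the integrals are finite). 4. (Pólya–Szegő) $\int_0^t\big((-f^*)'(\cdot)I(\cdot)\big)^*(s)\,ds\le\int_0^t|\nabla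 f|_\mu^*(s)\,ds$ for all $f\in\mathrm{Lip}(\Omega)$ and $t>0$, where the rearrangement on the left is with respect to Lebesgue measure on $(0,1)$. 5. (Oscillation) $f^{**}(t)-f^*(t)\le\frac{t}{I(t)}|\nabla f|_\mu^{**}(t)$ for all $f\in\mathrm{Lip}(\Omega)$ and $t\in(0,1)$. In these inequalities both sides may take the value $+\infty$. -/

import Mathlib

open Set Filter Topology MeasureTheory
open scoped ENNReal NNReal

noncomputable section

namespace IsoSymm

/-! ### Rearrangements -/

/-- The distribution function `ν_g (τ) = ν {g > τ}` of a `[0, ∞]`-valued function `g`.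
For a real function `u` it is applied to `g = |u|`. -/
def distrib {α : Type*} [MeasurableSpace α] (ν : Measure α) (g : α → ℝ≥0∞) (τ : ℝ≥0∞) : ℝ≥0∞ :=
  ν {x | τ < g x}

/-- The decreasing rearrangement `g^*_ν (s) = inf {τ ≥ 0 : ν_g (τ) ≤ s}`, for `s ≥ 0`. -/
def rearr {α : Type*} [MeasurableSpace α] (ν : Measure α) (g : α → ℝ≥0∞) (s : ℝ) : ℝ≥0∞ :=
  sInf {τ : ℝ≥0∞ | distrib ν g τ ≤ ENNReal.ofReal s}

/-- The maximal average `g^{**}_ν (t) = (1/t) ∫_0^t g^*_ν (s) ds`, for `t > 0`. -/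
def rearrAvg {α : Type*} [MeasurableSpace α] (ν : Measure α) (g : α → ℝ≥0∞) (t : ℝ) : ℝ≥0∞ :=
  (∫⁻ s in Ioo 0 t, rearr ν g s) / ENNReal.ofReal t

/-! ### Perimeter and isoperimetric profile -/

/-- The perimeter (lower Minkowski content) `μ⁺(A) = liminf_{h → 0+} (μ(A_h) - μ(A)) / h`, where
`A_h = {x : d(x, A) < h}`. -/
def perimeter {Ω : Type*} [MetricSpace Ω] [MeasurableSpace Ω] (μ : Measure Ω) (A : Set Ω) :
    ℝ≥0∞ :=
  liminf (fun h : ℝ => (μ (Metric.thickening h A) - μ A) / ENNReal.ofReal h) (𝓝[>] 0)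

/-- The isoperimetric profile: the largest function with `μ⁺(A) ≥ profile (μ(A))` for all Borel
sets `A`. -/
def profile {Ω : Type*} [MetricSpace Ω] [MeasurableSpace Ω] (μ : Measure Ω) (t : ℝ) : ℝ≥0∞ :=
  ⨅ (A : Set Ω) (_ : MeasurableSet A) (_ : μ A = ENNReal.ofReal t), perimeter μ A

/-- A function `I : [0, 1] → [0, ∞)` that is continuous, concave, increasing on `(0, 1/2)`,
symmetric about `1/2`, zero at `0` and positive inside `(0, 1)`. -/
structure IsProfileShape (I : ℝ → ℝ) : Prop where
  nonneg : ∀ t ∈ Icc (0 : ℝ) 1, 0 ≤ I t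
  continuousOn : ContinuousOn I (Icc 0 1)
  concaveOn : ConcaveOn ℝ (Icc 0 1) I
  monotoneOn : MonotoneOn I (Ioo 0 (1 / 2))
  symm : ∀ t ∈ Icc (0 : ℝ) 1, I (1 - t) = I t
  zero : I 0 = 0
  pos : ∀ t ∈ Ioo (0 : ℝ) 1, 0 < I t

/-- The profile of the space is finite and is itself of the above shape. -/
structure HasConcaveProfile {Ω : Type*} [MetricSpace Ω] [MeasurableSpace Ω] (μ : Measure Ω) :
    Prop where
  finite : ∀ t ∈ Icc (0 : ℝ) 1, profile μ t ≠ ∞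
  shape : IsProfileShape fun t => (profile μ t).toReal

/-- `I` is an isoperimetric estimator: it has the above shape and is at most the profile. -/
structure IsIsoperimetricEstimator {Ω : Type*} [MetricSpace Ω] [MeasurableSpace Ω]
    (μ : Measure Ω) (I : ℝ → ℝ) : Prop where
  shape : IsProfileShape I
  le_profile : ∀ t ∈ Icc (0 : ℝ) 1, ENNReal.ofReal (I t) ≤ profile μ t

/-! ### Lipschitz functions and the modulus of the gradient -/

/-- `f ∈ Lip(Ω)`: `f` is Lipschitz on every ball. -/
def IsLip {Ω : Type*} [MetricSpace Ω] (f : Ω → ℝ) : Prop :=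
  ∀ (x : Ω) (r : ℝ), ∃ K : ℝ≥0, LipschitzOnWith K f (Metric.ball x r)

/-- The modulus of the gradient `|∇f|(x) = limsup_{y → x, y ≠ x} |f(x) - f(y)| / d(x, y)`; it is
`0` at isolated points (the limsup along the trivial filter is the least element of `[0, ∞]`), and
it is finite for `f ∈ Lip(Ω)`. -/
def gradMod {Ω : Type*} [MetricSpace Ω] (f : Ω → ℝ) (x : Ω) : ℝ≥0∞ :=
  limsup (fun y => ‖f x - f y‖ₑ / edist x y) (𝓝[≠] x)

/-- Gradients vanish almost everywhere on level sets. -/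
def GradVanishesOnLevels {Ω : Type*} [MetricSpace Ω] [MeasurableSpace Ω] (μ : Measure Ω) : Prop :=
  ∀ f : Ω → ℝ, IsLip f → ∀ c : ℝ, ∀ᵐ x ∂μ, f x = c → gradMod f x = 0

/-- `f^*_μ` for a real function `f`. -/
def fnRearr {Ω : Type*} [MeasurableSpace Ω] (μ : Measure Ω) (f : Ω → ℝ) (s : ℝ) : ℝ≥0∞ :=
  rearr μ (fun x => ‖f x‖ₑ) s

/-- `f^*_μ` as a real-valued function (`f^*_μ (s)` is finite for `s > 0` when `f` is real-valued and
`μ` is a probability measure). -/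
def fnRearrReal {Ω : Type*} [MeasurableSpace Ω] (μ : Measure Ω) (f : Ω → ℝ) (s : ℝ) : ℝ :=
  (fnRearr μ f s).toReal

/-- The function `E(s) = ∫_{|f| > f^*(s)} |∇f| dμ`. -/
def levelEnergy {Ω : Type*} [MetricSpace Ω] [MeasurableSpace Ω] (μ : Measure Ω) (f : Ω → ℝ)
    (s : ℝ) : ℝ≥0∞ :=
  ∫⁻ x in {x | fnRearr μ f s < ‖f x‖ₑ}, gradMod f x ∂μ

/-- The increment `E(b) - E(a) = ∫_{f^*(b) < |f| ≤ f^*(a)} |∇f| dμ`, for `a ≤ b`. It is written as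
an integral so that it keeps its meaning where `E` is infinite; see `levelEnergy_add_incr`. -/
def levelEnergyIncr {Ω : Type*} [MetricSpace Ω] [MeasurableSpace Ω] (μ : Measure Ω) (f : Ω → ℝ)
    (a b : ℝ) : ℝ≥0∞ :=
  ∫⁻ x in {x | fnRearr μ f b < ‖f x‖ₑ ∧ ‖f x‖ₑ ≤ fnRearr μ f a}, gradMod f x ∂μ

/-- `E` has the (two-sided) derivative `D ∈ [0, ∞]` at `s`: both one-sided difference quotients
converge to `D`. -/
def HasLevelEnergyDeriv {Ω : Type*} [MetricSpace Ω] [MeasurableSpace Ω] (μ : Measure Ω)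
    (f : Ω → ℝ) (s : ℝ) (D : ℝ≥0∞) : Prop :=
  Tendsto (fun h : ℝ => levelEnergyIncr μ f s (s + h) / ENNReal.ofReal h) (𝓝[>] 0) (𝓝 D) ∧
  Tendsto (fun h : ℝ => levelEnergyIncr μ f (s - h) s / ENNReal.ofReal h) (𝓝[>] 0) (𝓝 D)

theorem rearr_antitone {α : Type*} [MeasurableSpace α] (ν : Measure α) (g : α → ℝ≥0∞) :
    Antitone (rearr ν g) := fun _ _ h =>
  sInf_le_sInf fun _ hτ => le_trans hτ (ENNReal.ofReal_le_ofReal h)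

theorem levelEnergy_add_incr {Ω : Type*} [MetricSpace Ω] [MeasurableSpace Ω] (μ : Measure Ω)
    {f : Ω → ℝ} (hf : Measurable f) {a b : ℝ} (hab : a ≤ b) :
    levelEnergy μ f a + levelEnergyIncr μ f a b = levelEnergy μ f b := by
  have h : fnRearr μ f b ≤ fnRearr μ f a := rearr_antitone _ _ hab
  have hm : MeasurableSet {x | fnRearr μ f b < ‖f x‖ₑ ∧ ‖f x‖ₑ ≤ fnRearr μ f a} :=
    (measurableSet_lt measurable_const hf.enorm).inter
      (measurableSet_le hf.enorm measurable_const)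
  unfold levelEnergy levelEnergyIncr
  rw [← lintegral_union hm]
  · congr 2
    ext x
    simp only [mem_union, mem_ofPred_eq]
    constructor
    · rintro (h1 | h1)
      · exact lt_of_le_of_lt h h1
      · exact h1.1
    · intro h1
      rcases lt_or_ge (fnRearr μ f a) ‖f x‖ₑ with h2 | h2
      · exact Or.inl h2
      · exact Or.inr ⟨h1, h2⟩
  · rw [Set.disjoint_left]
    intro x h1 h2
    exact absurd h1 (not_lt.mpr h2.2)

/-! ### The five inequalities -/

/-- Isoperimetric inequality: `μ⁺(A) ≥ I(μ(A))` for all Borel sets `A`. -/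
def IsoperimetricInequality {Ω : Type*} [MetricSpace Ω] [MeasurableSpace Ω] (μ : Measure Ω)
    (I : ℝ → ℝ) : Prop :=
  ∀ A : Set Ω, MeasurableSet A → ENNReal.ofReal (I (μ A).toReal) ≤ perimeter μ A

/-- Ledoux's inequality: `∫_0^∞ I(μ_f(s)) ds ≤ ∫ |∇f| dμ` for all `f ∈ Lip(Ω)`. -/
def LedouxInequality {Ω : Type*} [MetricSpace Ω] [MeasurableSpace Ω] (μ : Measure Ω)
    (I : ℝ → ℝ) : Prop :=
  ∀ f : Ω → ℝ, IsLip f →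
    ∫⁻ s in Ioi (0 : ℝ),
        ENNReal.ofReal (I (distrib μ (fun x => ‖f x‖ₑ) (ENNReal.ofReal s)).toReal) ≤
      ∫⁻ x, gradMod f x ∂μ

/-- Maz'ya's inequality: for all `f ∈ Lip(Ω)` and almost every `s ∈ (0, 1)` both derivatives exist
and `(-f^*)'(s) I(s) ≤ (d/ds) ∫_{|f| > f^*(s)} |∇f| dμ`. -/
def MazyaInequality {Ω : Type*} [MetricSpace Ω] [MeasurableSpace Ω] (μ : Measure Ω)
    (I : ℝ → ℝ) : Prop :=
  ∀ f : Ω → ℝ, IsLip f → ∀ᵐ s ∂(volume.restrict (Ioo (0 : ℝ) 1)),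
    ∃ (f' : ℝ) (D : ℝ≥0∞), HasDerivAt (fnRearrReal μ f) f' s ∧ HasLevelEnergyDeriv μ f s D ∧
      ENNReal.ofReal (-f' * I s) ≤ D

/-- Pólya–Szegő inequality: `∫_0^t ((-f^*)' I)^* (s) ds ≤ ∫_0^t |∇f|^*_μ (s) ds` for all
`f ∈ Lip(Ω)` and `t > 0`, the rearrangement of `(-f^*)' I` being taken with respect to Lebesgue
measure on `(0, 1)`. (The monotone function `f^*` is differentiable almost everywhere.) -/
def PolyaSzegoInequality {Ω : Type*} [MetricSpace Ω] [MeasurableSpace Ω] (μ : Measure Ω)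
    (I : ℝ → ℝ) : Prop :=
  ∀ f : Ω → ℝ, IsLip f → ∀ t : ℝ, 0 < t →
    ∫⁻ s in Ioo 0 t,
        rearr (volume.restrict (Ioo (0 : ℝ) 1)) (fun r => ‖-deriv (fnRearrReal μ f) r * I r‖ₑ) s ≤
      ∫⁻ s in Ioo 0 t, rearr μ (gradMod f) s

/-- Oscillation inequality: `f^{**}(t) - f^*(t) ≤ (t / I(t)) |∇f|^{**}(t)` for all `f ∈ Lip(Ω)` and
`t ∈ (0, 1)`. (Here `f^*(t)` is finite and at most `f^{**}(t)`.) -/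
def OscillationInequality {Ω : Type*} [MetricSpace Ω] [MeasurableSpace Ω] (μ : Measure Ω)
    (I : ℝ → ℝ) : Prop :=
  ∀ f : Ω → ℝ, IsLip f → ∀ t ∈ Ioo (0 : ℝ) 1,
    rearrAvg μ (fun x => ‖f x‖ₑ) t - fnRearr μ f t ≤
      ENNReal.ofReal (t / I t) * rearrAvg μ (gradMod f) t

end IsoSymm

end

namespace IsoSymm

/-! The implications close as 1 → 2 → 3 → 4 → 1 and 2 → 5 → 1.

1 → 2 is a coarea argument. The isoperimetric inequality is applied to the superlevel sets of a
function and integrated over the levels. Fatou's lemma replaces perimeters by difference quotients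
of measures of neighbourhoods, and Fubini bounds those by local slopes, which decrease to the
gradient. Cutoffs supply the integrability needed for this last limit.

2 → 3 and 2 → 5 apply Ledoux's inequality to truncations of `|f|`. Cutting between the levels
`f^*(b)` and `f^*(a)` leaves only level sets of measure in `[a, b]`, and the energy of the
truncation lives on the band because gradients vanish a.e. on level sets
(`LedouxInequality.mul_sub_le`). Dividing by `b - a` gives Maz'ya's inequality. For the oscillation
inequality the truncation is `(|f| - f^*(t))⁺`. Its level sets have measure `p ≤ t`, where concavity
gives `p ≤ (t / I(t)) I(p)`.

3 → 4 rests on the formula `∫_0^t g^* = min_k (t k + ∫ (g - k)⁺)`. It is enough to compare the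
integrals of `(· - k)⁺` for each `k`. This follows by integrating Maz'ya's inequality after
splitting the gradient into its excess over `k` and a remainder of at most `k`, since a band between
`f^*(b)` and `f^*(a)` has measure at most `b - a`.

4 → 1 and 5 → 1 test with Lipschitz approximations of indicator functions, whose energy is at most
`(μ(A_r) - μ(A)) / r`. In 4 → 1 the drop of `f^*` must be recovered from its a.e. derivative, so
`f^*` must be absolutely continuous. Ledoux's inequality for the profile of the space itself ensures
this. -/

/-- An integral over a set is unchanged when points where the integrand vanishes are added. -/
theorem setLIntegral_eq_of_diff_eq_zero {α : Type*} [MeasurableSpace α] {ν : Measure α}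
    {g : α → ℝ≥0∞} {S T : Set α} (hS : MeasurableSet S) (hT : MeasurableSet T) (hST : S ⊆ T)
    (h : ∀ x ∈ T \ S, g x = 0) : ∫⁻ x in S, g x ∂ν = ∫⁻ x in T, g x ∂ν := by
  rw [← lintegral_indicator hS, ← lintegral_indicator hT]
  refine lintegral_congr fun x => ?_
  by_cases hx : x ∈ S
  · simp [hx, hST hx]
  · by_cases hx' : x ∈ T
    · simp [hx, hx', h x ⟨hx', hx⟩]
    · simp [hx, hx']

/-! ### Rearrangements, equimeasurability and the variational formula -/

section Rearrangement

variable {α : Type*} [MeasurableSpace α] (ν : Measure α) (g : α → ℝ≥0∞)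

/-- The infimum defining the rearrangement is attained, because the distribution function is
right-continuous: `{τ < g}` is the increasing union of `{u n < g}` for any `u n` decreasing strictly
to `τ`. -/
theorem distrib_le_of_rearr_le {s : ℝ} {τ : ℝ≥0∞} (h : rearr ν g s ≤ τ) :
    distrib ν g τ ≤ ENNReal.ofReal s := by
  rcases eq_or_ne τ ∞ with rfl | hτ
  · simp [distrib]
  obtain ⟨u, hu, huτ, hlim⟩ := exists_seq_strictAnti_tendsto' (lt_top_iff_ne_top.2 hτ)
  have hU : {x | τ < g x} = ⋃ n, {x | u n < g x} := by
    ext x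
    simp only [mem_ofPred_eq, mem_iUnion]
    refine ⟨fun hx => ?_, fun ⟨n, hn⟩ => (huτ n).1.trans hn⟩
    exact (hlim.eventually (gt_mem_nhds hx)).exists
  have hmono : Monotone fun n => {x | u n < g x} := fun m n hmn x hx =>
    lt_of_le_of_lt (hu.antitone hmn) hx
  rw [distrib, hU, hmono.measure_iUnion]
  refine iSup_le fun n => ?_
  obtain ⟨σ, hσ, hσu⟩ := sInf_lt_iff.1 (lt_of_le_of_lt h (huτ n).1)
  exact (measure_mono fun x hx => lt_trans hσu hx).trans hσ

theorem lt_rearr_iff {s : ℝ} {τ : ℝ≥0∞} :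
    τ < rearr ν g s ↔ ENNReal.ofReal s < distrib ν g τ := by
  refine ⟨fun h => ?_, fun h => ?_⟩
  · by_contra! h'
    exact absurd (sInf_le h' : rearr ν g s ≤ τ) (not_le.2 h)
  · by_contra! h'
    exact absurd (distrib_le_of_rearr_le ν g h') (not_le.2 h)

theorem measurable_rearr : Measurable (rearr ν g) := (rearr_antitone ν g).measurable

variable [IsProbabilityMeasure ν]

theorem rearr_eq_zero {s : ℝ} (hs : 1 ≤ s) : rearr ν g s = 0 :=
  le_antisymm (sInf_le (prob_le_one.trans (by simpa using hs))) bot_le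

variable {g}

/-- The superlevel set of `g^*` inside `(0, 1)` is an interval starting at `0`, of length the
measure of the superlevel set of `g`. -/
theorem volume_lt_rearr (τ : ℝ≥0∞) :
    volume.restrict (Ioo (0 : ℝ) 1) {s | τ < rearr ν g s} = distrib ν g τ := by
  have h1 : distrib ν g τ ≤ 1 := prob_le_one
  have hfin : distrib ν g τ ≠ ∞ := (h1.trans_lt ENNReal.one_lt_top).ne
  have hset : {s | τ < rearr ν g s} ∩ Ioo (0 : ℝ) 1 = Ioo 0 (distrib ν g τ).toReal := by
    ext s
    simp only [mem_inter_iff, mem_ofPred_eq, mem_Ioo, lt_rearr_iff]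
    have h1' : (distrib ν g τ).toReal ≤ 1 := ENNReal.toReal_le_of_le_ofReal zero_le_one (by simpa)
    constructor
    · rintro ⟨h, h0, -⟩
      exact ⟨h0, (ENNReal.ofReal_lt_iff_lt_toReal h0.le hfin).1 h⟩
    · rintro ⟨h0, h⟩
      exact ⟨(ENNReal.ofReal_lt_iff_lt_toReal h0.le hfin).2 h, h0, h.trans_le h1'⟩
  rw [Measure.restrict_apply (measurableSet_lt measurable_const (measurable_rearr ν g)), hset,
    Real.volume_Ioo, sub_zero, ENNReal.ofReal_toReal hfin]

instance isProbabilityMeasure_restrict_Ioo :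
    IsProbabilityMeasure (volume.restrict (Ioo (0 : ℝ) 1)) := ⟨by simp⟩

theorem map_rearr (hg : AEMeasurable g ν) :
    Measure.map g ν = Measure.map (rearr ν g) (volume.restrict (Ioo (0 : ℝ) 1)) := by
  have h1 := Measure.isProbabilityMeasure_map hg
  have h2 := Measure.isProbabilityMeasure_map (μ := volume.restrict (Ioo (0 : ℝ) 1))
    (measurable_rearr ν g).aemeasurable
  refine Measure.ext_of_Iic _ _ fun τ => ?_
  rw [← compl_Ioi, prob_compl_eq_one_sub measurableSet_Ioi, prob_compl_eq_one_sub measurableSet_Ioi,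
    Measure.map_apply_of_aemeasurable hg measurableSet_Ioi,
    Measure.map_apply (measurable_rearr ν g) measurableSet_Ioi]
  congr 1
  exact (volume_lt_rearr ν τ).symm

theorem lintegral_comp_rearr (hg : AEMeasurable g ν) {φ : ℝ≥0∞ → ℝ≥0∞} (hφ : Measurable φ) :
    ∫⁻ x, φ (g x) ∂ν = ∫⁻ s in Ioo (0 : ℝ) 1, φ (rearr ν g s) := by
  rw [← lintegral_map' hφ.aemeasurable hg, map_rearr ν hg,
    lintegral_map hφ (measurable_rearr ν g)]

theorem lintegral_tsub_eq (hg : AEMeasurable g ν) (k : ℝ≥0∞) :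
    ∫⁻ x, (g x - k) ∂ν = ∫⁻ s in Ioi (0 : ℝ), (rearr ν g s - k) := by
  rw [lintegral_comp_rearr ν hg (φ := fun y => y - k) (by fun_prop)]
  refine setLIntegral_eq_of_diff_eq_zero measurableSet_Ioo measurableSet_Ioi
    (fun s hs => hs.1) fun s hs => ?_
  have : 1 ≤ s := by
    by_contra! h
    exact hs.2 ⟨hs.1, h⟩
  simp [rearr_eq_zero ν g this]

/-- Holds for every `k`, by `g^* ≤ k + (g^* - k)⁺` and equimeasurability. The choice `k = g^*(t)`
gives equality in `lintegral_rearr_eq`. -/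
theorem lintegral_rearr_le (hg : AEMeasurable g ν) (t : ℝ) (k : ℝ≥0∞) :
    ∫⁻ s in Ioo 0 t, rearr ν g s ≤ ENNReal.ofReal t * k + ∫⁻ x, (g x - k) ∂ν := by
  calc ∫⁻ s in Ioo 0 t, rearr ν g s ≤ ∫⁻ s in Ioo 0 t, (k + (rearr ν g s - k)) :=
        lintegral_mono fun s => le_add_tsub
    _ = ENNReal.ofReal t * k + ∫⁻ s in Ioo 0 t, (rearr ν g s - k) := by
        rw [lintegral_add_left measurable_const, setLIntegral_const, Real.volume_Ioo, sub_zero,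
          mul_comm]
    _ ≤ _ := by
        rw [lintegral_tsub_eq ν hg]
        gcongr
        exact fun s hs => hs.1

theorem lintegral_rearr_eq (hg : AEMeasurable g ν) (t : ℝ) :
    ∫⁻ s in Ioo 0 t, rearr ν g s =
      ENNReal.ofReal t * rearr ν g t + ∫⁻ x, (g x - rearr ν g t) ∂ν := by
  refine le_antisymm (lintegral_rearr_le ν hg t _) ?_
  have h : ∫⁻ x, (g x - rearr ν g t) ∂ν = ∫⁻ s in Ioo 0 t, (rearr ν g s - rearr ν g t) := by
    rw [lintegral_tsub_eq ν hg]
    refine (setLIntegral_eq_of_diff_eq_zero measurableSet_Ioo measurableSet_Ioi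
      (fun s hs => hs.1) fun s hs => ?_).symm
    have : t ≤ s := by
      by_contra! h
      exact hs.2 ⟨hs.1, h⟩
    exact tsub_eq_zero_of_le (rearr_antitone ν g this)
  calc _ = ∫⁻ s in Ioo 0 t, (rearr ν g t + (rearr ν g s - rearr ν g t)) := by
        rw [h, lintegral_add_left measurable_const, setLIntegral_const, Real.volume_Ioo, sub_zero,
          mul_comm]
    _ ≤ _ := by
        refine setLIntegral_mono (measurable_rearr ν g) fun s hs => ?_
        rw [add_tsub_cancel_of_le (rearr_antitone ν g hs.2.le)]

/-- The Hardy–Littlewood inequality for the indicator function of `S`. -/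
theorem setLIntegral_le_lintegral_rearr (hg : AEMeasurable g ν) {S : Set α} {t : ℝ}
    (hS : ν S ≤ ENNReal.ofReal t) :
    ∫⁻ x in S, g x ∂ν ≤ ∫⁻ s in Ioo 0 t, rearr ν g s := by
  rw [lintegral_rearr_eq ν hg]
  calc ∫⁻ x in S, g x ∂ν ≤ ∫⁻ x in S, (rearr ν g t + (g x - rearr ν g t)) ∂ν :=
        lintegral_mono fun s => le_add_tsub
    _ = ν S * rearr ν g t + ∫⁻ x in S, (g x - rearr ν g t) ∂ν := by
        rw [lintegral_add_left measurable_const, setLIntegral_const, mul_comm]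
    _ ≤ _ := by
        gcongr
        exact Measure.restrict_le_self

theorem lintegral_rearr_le_lintegral (hg : AEMeasurable g ν) (t : ℝ) :
    ∫⁻ s in Ioo 0 t, rearr ν g s ≤ ∫⁻ x, g x ∂ν := by
  simpa using lintegral_rearr_le ν hg t 0

end Rearrangement

/-! ### Difference quotients and the modulus of the gradient -/

section Gradient

variable {Ω : Type*} [MetricSpace Ω]

/-- The largest difference quotient of `f` between `x` and another point of the ball of
radius `h`. -/
noncomputable def slopeSup (f : Ω → ℝ) (h : ℝ) (x : Ω) : ℝ≥0∞ :=
  ⨆ y ∈ Metric.ball x h ∩ {x}ᶜ, ‖f x - f y‖ₑ / edist x y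

theorem gradMod_eq_iInf (f : Ω → ℝ) (x : Ω) :
    gradMod f x = ⨅ n : ℕ, slopeSup f (1 / ((n : ℝ) + 1)) x := by
  have := (nhdsWithin_hasBasis (Metric.nhds_basis_ball_inv_nat_succ (x := x)) {x}ᶜ)
  rw [gradMod, this.limsup_eq_iInf_iSup]
  simp [slopeSup]

theorem slopeSup_mono (f : Ω → ℝ) (x : Ω) {h h' : ℝ} (hh : h ≤ h') :
    slopeSup f h x ≤ slopeSup f h' x :=
  biSup_mono fun _ hy => ⟨Metric.ball_subset_ball hh hy.1, hy.2⟩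

theorem enorm_sub_le_slopeSup_mul (f : Ω → ℝ) {h : ℝ} {x y : Ω} (hy : dist y x < h) :
    ‖f x - f y‖ₑ ≤ slopeSup f h x * edist x y := by
  rcases eq_or_ne y x with rfl | hne
  · simp
  have h0 : edist x y ≠ 0 := by simpa [edist_eq_zero] using hne.symm
  rw [← ENNReal.div_le_iff h0 (edist_ne_top x y)]
  exact le_iSup₂_of_le (f := fun y _ => ‖f x - f y‖ₑ / edist x y) y ⟨hy, hne⟩ le_rfl

theorem slopeSup_le {f : Ω → ℝ} {h : ℝ} {x : Ω} {C : ℝ≥0∞}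
    (H : ∀ y, dist y x < h → ‖f x - f y‖ₑ ≤ C * edist x y) : slopeSup f h x ≤ C :=
  iSup₂_le fun y hy => ENNReal.div_le_of_le_mul (H y hy.1)

theorem slopeSup_le_add {f g : Ω → ℝ} {C : ℝ≥0∞}
    (H : ∀ x y, ‖g x - g y‖ₑ ≤ ‖f x - f y‖ₑ + C * edist x y) (h : ℝ) (x : Ω) :
    slopeSup g h x ≤ slopeSup f h x + C :=
  slopeSup_le fun y hy => (H x y).trans <| by
    rw [add_mul]
    gcongr
    exact enorm_sub_le_slopeSup_mul f hy

theorem gradMod_le_add {f g : Ω → ℝ} {C : ℝ≥0∞}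
    (H : ∀ x y, ‖g x - g y‖ₑ ≤ ‖f x - f y‖ₑ + C * edist x y) (x : Ω) :
    gradMod g x ≤ gradMod f x + C := by
  rw [gradMod_eq_iInf, gradMod_eq_iInf, ENNReal.iInf_add]
  exact iInf_mono fun n => slopeSup_le_add H _ x

theorem gradMod_le {f g : Ω → ℝ} (H : ∀ x y, ‖g x - g y‖ₑ ≤ ‖f x - f y‖ₑ) (x : Ω) :
    gradMod g x ≤ gradMod f x := by
  simpa using gradMod_le_add (C := 0) (fun x y => by simpa using H x y) x

theorem gradMod_le_of_lipschitz {g : Ω → ℝ} {C : ℝ≥0} (H : LipschitzWith C g) (x : Ω) :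
    gradMod g x ≤ C := by
  rw [gradMod_eq_iInf]
  refine iInf_le_of_le 0 (slopeSup_le fun y _ => ?_)
  rw [← edist_eq_enorm_sub]
  exact H x y

theorem IsLip.of_le {f g : Ω → ℝ} {C : ℝ≥0} (hf : IsLip f)
    (H : ∀ x y, ‖g x - g y‖ₑ ≤ ‖f x - f y‖ₑ + C * edist x y) : IsLip g := by
  intro x r
  obtain ⟨K, hK⟩ := hf x r
  refine ⟨K + C, fun y hy z hz => ?_⟩
  have := hK hy hz
  rw [edist_eq_enorm_sub] at this ⊢
  refine (H y z).trans ?_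
  push_cast
  rw [add_mul]
  gcongr

theorem IsLip.of_le' {f g : Ω → ℝ} (hf : IsLip f)
    (H : ∀ x y, ‖g x - g y‖ₑ ≤ ‖f x - f y‖ₑ) : IsLip g :=
  hf.of_le (C := 0) fun x y => by simpa using H x y

theorem isLip_of_lipschitzWith {f : Ω → ℝ} {C : ℝ≥0} (hf : LipschitzWith C f) : IsLip f :=
  fun _ _ => ⟨C, hf.lipschitzOnWith⟩

theorem IsLip.continuous {f : Ω → ℝ} (hf : IsLip f) : Continuous f := by
  rw [continuous_iff_continuousAt]
  intro x
  obtain ⟨K, hK⟩ := hf x 1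
  exact hK.continuousOn.continuousAt (Metric.ball_mem_nhds x one_pos)

/-- Lower semicontinuity: for a fixed competitor `y`, beating the slope `a` is an open condition on
`x`, and the set is the union over all `y`. -/
theorem isOpen_lt_slopeSup {f : Ω → ℝ} (hf : Continuous f) (h : ℝ) (a : ℝ≥0∞) :
    IsOpen {x | a < slopeSup f h x} := by
  rcases eq_or_ne a ∞ with rfl | ha
  · simp
  have : {x | a < slopeSup f h x} =
      ⋃ y, ({x | dist y x < h} ∩ {x | y ≠ x}) ∩ {x | a * edist x y < ‖f x - f y‖ₑ} := by
    ext x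
    simp only [slopeSup, lt_iSup_iff, mem_ofPred_eq, mem_iUnion, mem_inter_iff, exists_prop,
      Metric.mem_ball, mem_compl_iff, mem_singleton_iff]
    refine exists_congr fun y => and_congr_right fun hy => ?_
    have h0 : edist x y ≠ 0 := by simpa [edist_eq_zero] using fun h' => hy.2 h'.symm
    rw [ENNReal.lt_div_iff_mul_lt (Or.inl h0) (Or.inl (edist_ne_top x y))]
  rw [this]
  refine isOpen_iUnion fun y => IsOpen.inter (IsOpen.inter ?_ ?_) ?_
  · exact isOpen_lt (by fun_prop) continuous_const
  · exact isOpen_ne_fun continuous_const continuous_id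
  · exact isOpen_lt ((ENNReal.continuous_const_mul ha).comp (by fun_prop)) (by fun_prop)

variable [MeasurableSpace Ω] [BorelSpace Ω]

theorem measurable_slopeSup {f : Ω → ℝ} (hf : Continuous f) (h : ℝ) :
    Measurable (slopeSup f h) :=
  measurable_of_Ioi fun a => (isOpen_lt_slopeSup hf h a).measurableSet

theorem measurable_gradMod {f : Ω → ℝ} (hf : Continuous f) : Measurable (gradMod f) := by
  have : gradMod f = fun x => ⨅ n : ℕ, slopeSup f (1 / ((n : ℝ) + 1)) x :=
    funext (gradMod_eq_iInf f)
  rw [this]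
  exact Measurable.iInf fun n => measurable_slopeSup hf _

end Gradient

/-! ### A coarea inequality from isoperimetry -/

section Coarea

variable {Ω : Type*} [MetricSpace Ω] [MeasurableSpace Ω] [BorelSpace Ω] (μ : Measure Ω)
  [IsProbabilityMeasure μ]

/-- Fubini: for fixed `x`, the levels `s` counted on the left satisfy `g x ≤ s < g y` for some `y`
within `h` of `x`, so they fill an interval of length at most `h` times the local slope. -/
theorem lintegral_thickening_sub_le {g : Ω → ℝ} (hg : Continuous g) {h : ℝ} (hh : 0 < h) :
    ∫⁻ s in Ioi (0 : ℝ), (μ (Metric.thickening h {x | s < g x}) - μ {x | s < g x}) ≤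
      ENNReal.ofReal h * ∫⁻ x, slopeSup g h x ∂μ := by
  -- Pairs `(s, x)` such that `x` is in the `h`-neighbourhood of `{g > s}` but not in `{g > s}`.
  set S : Set (ℝ × Ω) := (⋃ y, Iio (g y) ×ˢ Metric.ball y h) ∩ {p | g p.2 ≤ p.1} with hS
  have hSm : MeasurableSet S :=
    (isOpen_iUnion fun y => isOpen_Iio.prod Metric.isOpen_ball).measurableSet.inter
      (isClosed_le (hg.comp continuous_snd) continuous_fst).measurableSet
  have hsec : ∀ s, μ (Metric.thickening h {x | s < g x}) - μ {x | s < g x} =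
      μ (Prod.mk s ⁻¹' S) := by
    intro s
    rw [← measure_sdiff (Metric.self_subset_thickening hh _)
      (isOpen_lt continuous_const hg).measurableSet.nullMeasurableSet (measure_ne_top _ _)]
    congr 1
    ext x
    simp [hS, Metric.mem_thickening_iff]
  calc _ = ∫⁻ s in Ioi (0 : ℝ), μ (Prod.mk s ⁻¹' S) := by simp_rw [hsec]
    _ ≤ ∫⁻ s, μ (Prod.mk s ⁻¹' S) := setLIntegral_le_lintegral _ _
    _ = ∫⁻ x, volume ((fun s => (s, x)) ⁻¹' S) ∂μ := by
        rw [← Measure.prod_apply hSm, Measure.prod_apply_symm hSm]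
    _ ≤ ∫⁻ x, ENNReal.ofReal h * slopeSup g h x ∂μ := by
        refine lintegral_mono fun x => ?_
        rcases eq_or_ne (ENNReal.ofReal h * slopeSup g h x) ∞ with htop | htop
        · simp [htop]
        have hsub : (fun s => (s, x)) ⁻¹' S ⊆
            Ico (g x) (g x + (ENNReal.ofReal h * slopeSup g h x).toReal) := by
          rintro s ⟨hs1, hs2⟩
          simp only [mem_iUnion, mem_prod, mem_Iio, Metric.mem_ball] at hs1
          obtain ⟨y, hsy, hxy⟩ := hs1
          refine ⟨hs2, ?_⟩
          have h1 : ‖g x - g y‖ₑ ≤ ENNReal.ofReal h * slopeSup g h x := by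
            refine (enorm_sub_le_slopeSup_mul g (by rwa [dist_comm] at hxy)).trans ?_
            rw [mul_comm, edist_dist]
            gcongr
          have h2 : |g x - g y| ≤ (ENNReal.ofReal h * slopeSup g h x).toReal := by
            rw [← Real.norm_eq_abs, ← toReal_enorm]
            exact ENNReal.toReal_mono htop h1
          have h3 := neg_le_abs (g x - g y)
          linarith
        refine (measure_mono hsub).trans ?_
        rw [Real.volume_Ico, add_sub_cancel_left, ENNReal.ofReal_toReal htop]
    _ = _ := lintegral_const_mul _ (measurable_slopeSup hg h)

variable {μ}

/-- Fatou's lemma in the level variable, then decreasing convergence of the slopes to the gradient.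
The second limit is where the finite integral at scale `1` is needed. -/
theorem IsoperimetricInequality.lintegral_le_of_slopeSup {I : ℝ → ℝ}
    (hI : IsoperimetricInequality μ I) {g : Ω → ℝ} (hg : Continuous g)
    (hfin : ∫⁻ x, slopeSup g 1 x ∂μ ≠ ∞) :
    ∫⁻ s in Ioi (0 : ℝ), ENNReal.ofReal (I (μ {x | s < g x}).toReal) ≤ ∫⁻ x, gradMod g x ∂μ := by
  set u : ℕ → ℝ := fun n => 1 / ((n : ℝ) + 1) with hu
  have hpos : ∀ n, 0 < u n := fun n => by positivity
  have hlim : Tendsto u atTop (𝓝[>] 0) :=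
    tendsto_nhdsWithin_iff.2 ⟨tendsto_one_div_add_atTop_nhds_zero_nat, .of_forall hpos⟩
  have hanti : Antitone fun n => ∫⁻ x, slopeSup g (u n) x ∂μ := fun m n hmn =>
    lintegral_mono fun x => slopeSup_mono g x (Nat.one_div_le_one_div hmn)
  let F : ℝ → ℝ → ℝ≥0∞ := fun h s =>
    (μ (Metric.thickening h {x | s < g x}) - μ {x | s < g x}) / ENNReal.ofReal h
  have hF : ∀ h, Measurable (F h) := by
    intro h
    have h1 : Antitone fun s : ℝ => {x | s < g x} := fun s t hst x hx => lt_of_le_of_lt hst hx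
    have h2 : Antitone fun s => μ (Metric.thickening h {x | s < g x}) := fun s t hst =>
      measure_mono (Metric.thickening_subset_of_subset h (h1 hst))
    have h3 : Antitone fun s => μ {x | s < g x} := fun s t hst => measure_mono (h1 hst)
    exact (h2.measurable.sub h3.measurable).div_const _
  calc _ ≤ ∫⁻ s in Ioi (0 : ℝ), liminf (fun n => F (u n) s) atTop := by
        refine lintegral_mono fun s => ?_
        refine (hI _ (isOpen_lt continuous_const hg).measurableSet).trans ?_
        exact liminf_le_liminf_of_le (f := 𝓝[>] 0) (g := map u atTop) hlim
    _ ≤ liminf (fun n => ∫⁻ s in Ioi (0 : ℝ), F (u n) s) atTop :=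
        lintegral_liminf_le fun n => hF _
    _ ≤ liminf (fun n => ∫⁻ x, slopeSup g (u n) x ∂μ) atTop := by
        refine liminf_le_liminf (.of_forall fun n => ?_)
        simp only [F, div_eq_mul_inv]
        rw [lintegral_mul_const' _ _ (by simpa using hpos n), ← div_eq_mul_inv]
        refine ENNReal.div_le_of_le_mul ?_
        rw [mul_comm]
        exact lintegral_thickening_sub_le μ hg (hpos n)
    _ = ⨅ n, ∫⁻ x, slopeSup g (u n) x ∂μ := (tendsto_atTop_iInf hanti).liminf_eq
    _ = ∫⁻ x, ⨅ n, slopeSup g (u n) x ∂μ := by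
        refine (lintegral_iInf (fun n => measurable_slopeSup hg _)
          (fun m n hmn x => slopeSup_mono g x (Nat.one_div_le_one_div hmn)) ?_).symm
        simpa [hu] using hfin
    _ = _ := by simp_rw [gradMod_eq_iInf, hu]

end Coarea

theorem enorm_le_add_of_abs_le {Ω : Type*} [MetricSpace Ω] {x y : Ω} {a b : ℝ} {C : ℝ≥0}
    (h : |a| ≤ |b| + C * dist x y) : ‖a‖ₑ ≤ ‖b‖ₑ + C * edist x y := by
  rw [Real.enorm_eq_ofReal_abs, Real.enorm_eq_ofReal_abs, edist_dist, ← ENNReal.ofReal_coe_nnreal,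
    ← ENNReal.ofReal_mul C.coe_nonneg, ← ENNReal.ofReal_add (abs_nonneg _) (by positivity)]
  exact ENNReal.ofReal_le_ofReal h

theorem IsProfileShape.measurable_comp {I : ℝ → ℝ} (hI : IsProfileShape I) {m : ℝ → ℝ}
    (hm : Measurable m) (h : ∀ s, m s ∈ Icc (0 : ℝ) 1) : Measurable fun s => I (m s) := by
  -- Nothing is known about `I` outside `[0, 1]`, so it is replaced by its constant continuous
  -- extension.
  have h1 : Continuous (IccExtend (zero_le_one' ℝ) ((Icc (0 : ℝ) 1).domRestrict I)) :=
    (continuousOn_iff_continuous_domRestrict.1 hI.continuousOn).Icc_extend'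
  convert h1.measurable.comp hm using 2 with s
  simp [IccExtend_of_mem _ _ (h s)]

theorem toReal_measure_mem_Icc {α : Type*} [MeasurableSpace α] (ν : Measure α)
    [IsProbabilityMeasure ν] (S : Set α) : (ν S).toReal ∈ Icc (0 : ℝ) 1 :=
  ⟨ENNReal.toReal_nonneg, ENNReal.toReal_le_of_le_ofReal zero_le_one (by simpa using prob_le_one)⟩

/-! ### Localisation of functions that are Lipschitz on balls -/

section Cutoff

variable {Ω : Type*} [MetricSpace Ω]

/-- The truncation of `|f|` by a function which vanishes outside a ball around `o` and has
slope `1 / (n + 1)`. -/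
noncomputable def cutoff (f : Ω → ℝ) (o : Ω) (n : ℕ) (x : Ω) : ℝ :=
  min |f x| (max 0 ((n + 1) - dist x o / (n + 1)))

theorem cutoff_mono (f : Ω → ℝ) (o : Ω) (x : Ω) : Monotone fun n => cutoff f o n x := by
  intro m n hmn
  have h : (m : ℝ) ≤ n := by exact_mod_cast hmn
  simp only [cutoff]
  gcongr

theorem exists_lt_cutoff (f : Ω → ℝ) (o : Ω) {x : Ω} {s : ℝ} (hs : s < |f x|) :
    ∃ n, s < cutoff f o n x := by
  obtain ⟨n, hn⟩ := exists_nat_gt (s + dist x o)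
  refine ⟨n, lt_min hs (lt_max_of_lt_right ?_)⟩
  have h1 : dist x o / (n + 1) ≤ dist x o := div_le_self dist_nonneg (by simp)
  linarith

theorem abs_cutoff_sub_le (f : Ω → ℝ) (o : Ω) (n : ℕ) (x y : Ω) :
    |cutoff f o n x - cutoff f o n y| ≤
      |f x - f y| + ((1 / ((n : ℝ≥0) + 1) : ℝ≥0) : ℝ) * dist x y := by
  have hn : (0 : ℝ) < n + 1 := by positivity
  refine (abs_min_sub_min_le_max _ _ _ _).trans (max_le ?_ ?_)
  · exact (abs_abs_sub_abs_le _ _).trans (le_add_of_nonneg_right (by positivity))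
  · refine le_trans ?_ (le_add_of_nonneg_left (abs_nonneg _))
    refine (abs_max_sub_max_le_max _ _ _ _).trans (max_le (by simp; positivity) ?_)
    rw [show (n : ℝ) + 1 - dist x o / (n + 1) - (n + 1 - dist y o / (n + 1)) =
      (dist y o - dist x o) / (n + 1) by ring, abs_div, abs_of_pos hn]
    push_cast
    rw [div_mul_eq_mul_div, one_mul]
    gcongr
    rw [dist_comm x y]
    exact abs_dist_sub_le _ _ _

theorem enorm_cutoff_sub_le (f : Ω → ℝ) (o : Ω) (n : ℕ) (x y : Ω) :
    ‖cutoff f o n x - cutoff f o n y‖ₑ ≤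
      ‖f x - f y‖ₑ + ((1 / ((n : ℝ≥0) + 1) : ℝ≥0) : ℝ≥0∞) * edist x y :=
  enorm_le_add_of_abs_le (abs_cutoff_sub_le f o n x y)

theorem cutoff_eq_zero (f : Ω → ℝ) (o : Ω) (n : ℕ) {x : Ω} (hx : ((n : ℝ) + 1) ^ 2 ≤ dist x o) :
    cutoff f o n x = 0 := by
  have hn : (0 : ℝ) < n + 1 := by positivity
  have : (n : ℝ) + 1 - dist x o / (n + 1) ≤ 0 := by
    rw [sub_nonpos, le_div_iff₀ hn]
    linarith
  rw [cutoff, max_eq_left this, min_eq_right (abs_nonneg _)]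

/-- The cutoff vanishes outside the ball of radius `(n + 1)^2`, so one Lipschitz constant of `f` on
a slightly larger ball suffices. The margin `2` covers a point up to `1` outside the support and its
competitor at distance less than `1`. -/
theorem exists_slopeSup_cutoff_le {f : Ω → ℝ} (hf : IsLip f) (o : Ω) (n : ℕ) :
    ∃ C : ℝ≥0, ∀ x, slopeSup (cutoff f o n) 1 x ≤ C := by
  obtain ⟨K, hK⟩ := hf o (((n : ℝ) + 1) ^ 2 + 2)
  refine ⟨K + 1 / ((n : ℝ≥0) + 1), fun x => slopeSup_le fun y hy => ?_⟩
  rcases lt_or_ge (dist x o) (((n : ℝ) + 1) ^ 2 + 1) with hx | hx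
  · refine (enorm_cutoff_sub_le f o n x y).trans ?_
    rw [ENNReal.coe_add, add_mul, ← edist_eq_enorm_sub]
    gcongr
    refine hK ?_ ?_
    · rw [Metric.mem_ball]
      linarith
    · rw [Metric.mem_ball]
      linarith [dist_triangle y x o]
  · rw [cutoff_eq_zero f o n (by linarith),
      cutoff_eq_zero f o n (by linarith [dist_triangle_left x o y])]
    simp

end Cutoff

/-! ### From isoperimetry to Ledoux's inequality -/

section Ledoux

variable {Ω : Type*} [MetricSpace Ω] [MeasurableSpace Ω] [BorelSpace Ω] {μ : Measure Ω}

variable [IsProbabilityMeasure μ] {I : ℝ → ℝ}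

/-- The cutoffs increase to `|f|`, so the measures of their level sets converge and continuity of
`I` passes to the limit. Their gradients exceed that of `f` by at most `1 / (n + 1)`, which is
negligible for a probability measure. -/
theorem IsoperimetricInequality.ledoux (hI : IsProfileShape I) (h : IsoperimetricInequality μ I) :
    LedouxInequality μ I := by
  intro f hf
  obtain ⟨o⟩ := nonempty_of_isProbabilityMeasure μ
  let G : ℕ → Ω → ℝ := fun n => cutoff f o n
  let F : ℕ → ℝ → ℝ≥0∞ := fun n s => ENNReal.ofReal (I (μ {x | s < G n x}).toReal)
  have hGlip : ∀ n, IsLip (G n) := fun n => hf.of_le (enorm_cutoff_sub_le f o n)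
  have hF : ∀ n, Measurable (F n) := by
    intro n
    refine (hI.measurable_comp ?_ fun s => toReal_measure_mem_Icc μ _).ennreal_ofReal
    have : Antitone fun s : ℝ => (μ {x | s < G n x}).toReal := fun s t hst =>
      ENNReal.toReal_mono (measure_ne_top _ _) (measure_mono fun x hx => lt_of_le_of_lt hst hx)
    exact this.measurable
  have hlim : ∀ s ∈ Ioi (0 : ℝ), Tendsto (fun n => F n s) atTop
      (𝓝 (ENNReal.ofReal (I (distrib μ (fun x => ‖f x‖ₑ) (ENNReal.ofReal s)).toReal))) := by
    intro s hs
    have hU : {x | ENNReal.ofReal s < ‖f x‖ₑ} = ⋃ n, {x | s < G n x} := by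
      ext x
      simp only [mem_ofPred_eq, mem_iUnion, Real.enorm_eq_ofReal_abs,
        ENNReal.ofReal_lt_ofReal_iff_of_nonneg (le_of_lt hs)]
      exact ⟨fun hx => exists_lt_cutoff f o hx, fun ⟨n, hn⟩ => hn.trans_le (min_le_left _ _)⟩
    have hmono : Monotone fun n => {x | s < G n x} := fun m n hmn x hx =>
      lt_of_lt_of_le hx (cutoff_mono f o x hmn)
    have h1 : Tendsto (fun n => (μ {x | s < G n x}).toReal) atTop
        (𝓝 (distrib μ (fun x => ‖f x‖ₑ) (ENNReal.ofReal s)).toReal) := by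
      rw [distrib, hU]
      exact (ENNReal.tendsto_toReal (measure_ne_top _ _)).comp
        (tendsto_measure_iUnion_atTop hmono)
    refine ENNReal.tendsto_ofReal ?_
    exact ((hI.continuousOn _ (toReal_measure_mem_Icc μ _)).tendsto).comp
      (tendsto_nhdsWithin_iff.2 ⟨h1, .of_forall fun n => toReal_measure_mem_Icc μ _⟩)
  calc _ = ∫⁻ s in Ioi (0 : ℝ), liminf (fun n => F n s) atTop :=
        setLIntegral_congr_fun measurableSet_Ioi fun s hs => (hlim s hs).liminf_eq.symm
    _ ≤ liminf (fun n => ∫⁻ s in Ioi (0 : ℝ), F n s) atTop := lintegral_liminf_le hF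
    _ ≤ liminf (fun n : ℕ => ∫⁻ x, gradMod f x ∂μ + ((1 / ((n : ℝ≥0) + 1) : ℝ≥0) : ℝ≥0∞))
        atTop := by
        refine liminf_le_liminf (.of_forall fun n => ?_)
        obtain ⟨C, hC⟩ := exists_slopeSup_cutoff_le hf o n
        refine (h.lintegral_le_of_slopeSup (hGlip n).continuous ?_).trans ?_
        · refine ((lintegral_mono hC).trans_lt ?_).ne
          simp
        · refine (lintegral_mono fun x => gradMod_le_add (enorm_cutoff_sub_le f o n) x).trans ?_
          rw [lintegral_add_right _ measurable_const]
          simp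
    _ = ∫⁻ x, gradMod f x ∂μ := by
        refine Tendsto.liminf_eq ?_
        have : Tendsto (fun n : ℕ => (1 / ((n : ℝ≥0) + 1) : ℝ≥0)) atTop (𝓝 0) :=
          tendsto_one_div_add_atTop_nhds_zero_nat
        simpa using tendsto_const_nhds.add (ENNReal.tendsto_coe.2 this)

end Ledoux

/-! ### Bands between two values of the rearrangement -/

section Bands

variable {α : Type*} [MeasurableSpace α] (ν : Measure α)

theorem fnRearr_antitone (f : α → ℝ) : Antitone (fnRearr ν f) := rearr_antitone _ _

theorem distrib_enorm (f : α → ℝ) {s : ℝ} (hs : 0 ≤ s) :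
    distrib ν (fun x => ‖f x‖ₑ) (ENNReal.ofReal s) = ν {x | s < |f x|} := by
  simp only [distrib, Real.enorm_eq_ofReal_abs, ENNReal.ofReal_lt_ofReal_iff_of_nonneg hs]

variable [IsProbabilityMeasure ν]

theorem ofReal_le_measure_rearr_le {g : α → ℝ≥0∞} (hg : Measurable g) {a : ℝ} (ha : a ≤ 1) :
    ENNReal.ofReal a ≤ ν {x | rearr ν g a ≤ g x} := by
  rcases eq_or_ne (rearr ν g a) 0 with h0 | h0
  · simpa [h0] using ha
  obtain ⟨u, hu, hua, hlim⟩ := exists_seq_strictMono_tendsto' (pos_iff_ne_zero.2 h0)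
  have hI : {x | rearr ν g a ≤ g x} = ⋂ n, {x | u n < g x} := by
    ext x
    simp only [mem_ofPred_eq, mem_iInter]
    exact ⟨fun hx n => (hua n).2.trans_le hx, fun hx => le_of_tendsto' hlim fun n => (hx n).le⟩
  have hanti : Antitone fun n => {x | u n < g x} := fun m n hmn x hx =>
    lt_of_le_of_lt (hu.monotone hmn) hx
  rw [hI, hanti.measure_iInter
    (fun n => (measurableSet_lt measurable_const hg).nullMeasurableSet) ⟨0, measure_ne_top _ _⟩]
  exact le_iInf fun n => ((lt_rearr_iff ν g).1 (hua n).2).le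

/-- `{g > g^*(b)}` has measure at most `b` and `{g ≥ g^*(a)}` at least `a`. The strict upper bound
matters: the level `g = g^*(a)` may carry positive mass. -/
theorem measure_band_le {g : α → ℝ≥0∞} (hg : Measurable g) {a b : ℝ} (ha : 0 ≤ a) (ha' : a ≤ 1) :
    ν {x | rearr ν g b < g x ∧ g x < rearr ν g a} ≤ ENNReal.ofReal (b - a) := by
  rcases le_or_gt (rearr ν g a) (rearr ν g b) with h | h
  · have : {x | rearr ν g b < g x ∧ g x < rearr ν g a} = ∅ :=
      eq_empty_of_forall_notMem fun x hx => (hx.1.trans hx.2).not_ge h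
    simp [this]
  · have : {x | rearr ν g b < g x ∧ g x < rearr ν g a} =
        {x | rearr ν g b < g x} \ {x | rearr ν g a ≤ g x} := by
      ext x
      simp
    have hsub : {x | rearr ν g a ≤ g x} ⊆ {x | rearr ν g b < g x} := fun x hx => h.trans_le hx
    rw [this, measure_sdiff hsub
      (measurableSet_le measurable_const hg).nullMeasurableSet (measure_ne_top _ _),
      ENNReal.ofReal_sub _ ha]
    exact tsub_le_tsub (distrib_le_of_rearr_le ν g le_rfl) (ofReal_le_measure_rearr_le ν hg ha')

theorem fnRearr_ne_top {f : α → ℝ} (hf : Measurable f) {s : ℝ} (hs : 0 < s) :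
    fnRearr ν f s ≠ ∞ := by
  intro htop
  have hI : ⋂ n : ℕ, {x | (n : ℝ≥0∞) < ‖f x‖ₑ} = ∅ := by
    refine eq_empty_of_forall_notMem fun x hx => ?_
    obtain ⟨n, hn⟩ := ENNReal.exists_nat_gt (enorm_ne_top (x := f x))
    exact lt_asymm hn (mem_iInter.1 hx n)
  have hanti : Antitone fun n : ℕ => {x | (n : ℝ≥0∞) < ‖f x‖ₑ} := fun m n hmn x (hx : _ < _) =>
    (lt_of_le_of_lt (Nat.cast_le.2 hmn) hx : (m : ℝ≥0∞) < ‖f x‖ₑ)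
  have h1 := hanti.measure_iInter (μ := ν)
    (fun n => (measurableSet_lt measurable_const hf.enorm).nullMeasurableSet)
    ⟨0, measure_ne_top _ _⟩
  rw [hI, measure_empty] at h1
  have h2 : ENNReal.ofReal s ≤ 0 := by
    rw [h1]
    refine le_iInf fun n => ((lt_rearr_iff ν _).1 ?_).le
    change _ < fnRearr ν f s
    rw [htop]
    exact ENNReal.natCast_lt_top n
  simp only [nonpos_iff_eq_zero, ENNReal.ofReal_eq_zero] at h2
  exact absurd hs (not_lt.2 h2)

theorem ofReal_fnRearrReal {f : α → ℝ} (hf : Measurable f) {s : ℝ} (hs : 0 < s) :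
    ENNReal.ofReal (fnRearrReal ν f s) = fnRearr ν f s :=
  ENNReal.ofReal_toReal (fnRearr_ne_top ν hf hs)

theorem fnRearrReal_antitoneOn {f : α → ℝ} (hf : Measurable f) :
    AntitoneOn (fnRearrReal ν f) (Ioi 0) := fun _ ha _ _ hab =>
  ENNReal.toReal_mono (fnRearr_ne_top ν hf ha) (fnRearr_antitone ν f hab)

end Bands

/-! ### Energy of truncations; from Ledoux to the oscillation inequality -/

variable {Ω : Type*} [MetricSpace Ω] [MeasurableSpace Ω] {μ : Measure Ω}

/-- If `g` is a contraction of `f` which takes at most two values outside `S`, then the energy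
of `g` is at most that of `f` on `S`. -/
theorem GradVanishesOnLevels.lintegral_le (hgrad : GradVanishesOnLevels μ) {f g : Ω → ℝ}
    (hf : IsLip f) (H : ∀ x y, |g x - g y| ≤ |f x - f y|) {S : Set Ω} (hS : MeasurableSet S)
    {c₁ c₂ : ℝ} (hc : ∀ x ∉ S, g x = c₁ ∨ g x = c₂) :
    ∫⁻ x, gradMod g x ∂μ ≤ ∫⁻ x in S, gradMod f x ∂μ := by
  have H' : ∀ x y, ‖g x - g y‖ₑ ≤ ‖f x - f y‖ₑ := fun x y => by
    rw [Real.enorm_eq_ofReal_abs, Real.enorm_eq_ofReal_abs]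
    exact ENNReal.ofReal_le_ofReal (H x y)
  have hg : IsLip g := hf.of_le' H'
  rw [← lintegral_indicator hS]
  refine lintegral_mono_ae ?_
  filter_upwards [hgrad g hg c₁, hgrad g hg c₂] with x h1 h2
  by_cases hx : x ∈ S
  · simpa [hx] using gradMod_le H' x
  · have : gradMod g x = 0 := (hc x hx).elim h1 h2
    simp [this]

variable [BorelSpace Ω]

theorem IsLip.measurableSet_band {f : Ω → ℝ} (hf : IsLip f) (a b : ℝ≥0∞) :
    MeasurableSet {x | b < ‖f x‖ₑ ∧ ‖f x‖ₑ < a} :=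
  (measurableSet_lt measurable_const hf.continuous.measurable.enorm).inter
    (measurableSet_lt hf.continuous.measurable.enorm measurable_const)

theorem IsLip.measurableSet_band' {f : Ω → ℝ} (hf : IsLip f) (a b : ℝ≥0∞) :
    MeasurableSet {x | b < ‖f x‖ₑ ∧ ‖f x‖ₑ ≤ a} :=
  (measurableSet_lt measurable_const hf.continuous.measurable.enorm).inter
    (measurableSet_le hf.continuous.measurable.enorm measurable_const)

/-- The top level `|f| = f^*(a)` consists of two level sets of `f`, where the gradient vanishes a.e.
Removing it gives the band to which `measure_band_le` applies. -/
theorem GradVanishesOnLevels.levelEnergyIncr_le (hgrad : GradVanishesOnLevels μ) {f : Ω → ℝ}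
    (hf : IsLip f) (a b : ℝ) :
    levelEnergyIncr μ f a b ≤
      ∫⁻ x in {x | fnRearr μ f b < ‖f x‖ₑ ∧ ‖f x‖ₑ < fnRearr μ f a}, gradMod f x ∂μ := by
  rw [levelEnergyIncr, ← lintegral_indicator (hf.measurableSet_band' _ _),
    ← lintegral_indicator (hf.measurableSet_band _ _)]
  refine lintegral_mono_ae ?_
  filter_upwards [hgrad f hf (fnRearr μ f a).toReal, hgrad f hf (-(fnRearr μ f a).toReal)]
    with x h1 h2
  rcases eq_or_ne ‖f x‖ₑ (fnRearr μ f a) with h | h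
  · have h3 : |f x| = (fnRearr μ f a).toReal := by
      rw [← h, toReal_enorm, Real.norm_eq_abs]
    have : gradMod f x = 0 := (abs_eq ENNReal.toReal_nonneg).1 h3 |>.elim h1 h2
    exact (indicator_le_self _ _ _).trans (by simp [this])
  · by_cases hx : x ∈ {x | fnRearr μ f b < ‖f x‖ₑ ∧ ‖f x‖ₑ ≤ fnRearr μ f a}
    · have hx' : x ∈ {x | fnRearr μ f b < ‖f x‖ₑ ∧ ‖f x‖ₑ < fnRearr μ f a} :=
        ⟨hx.1, lt_of_le_of_ne hx.2 h⟩
      rw [indicator_of_mem hx, indicator_of_mem hx']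
    · rw [indicator_of_notMem hx]
      exact bot_le

theorem abs_trunc_sub_le (A B u v : ℝ) :
    |max 0 (min |u| A - B) - max 0 (min |v| A - B)| ≤ |u - v| := by
  refine (abs_max_sub_max_le_max _ _ _ _).trans (max_le (by simp) ?_)
  rw [sub_sub_sub_cancel_right]
  exact (abs_min_sub_min_le_max _ _ _ _).trans (max_le (abs_abs_sub_abs_le _ _) (by simp))

theorem abs_posPart_sub_le (B u v : ℝ) :
    |max 0 (|u| - B) - max 0 (|v| - B)| ≤ |u - v| := by
  refine (abs_max_sub_max_le_max _ _ _ _).trans (max_le (by simp) ?_)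
  rw [sub_sub_sub_cancel_right]
  exact abs_abs_sub_abs_le _ _

variable [IsProbabilityMeasure μ] {I : ℝ → ℝ}

/-- Ledoux's inequality for `|f|` clipped to `[f^*(b), f^*(a)]` and shifted to start at `0`. Every
level strictly between the two values cuts out a set of measure in `[a, b]`, where `I ≥ m`. -/
theorem LedouxInequality.mul_sub_le (h : LedouxInequality μ I) (hgrad : GradVanishesOnLevels μ)
    {f : Ω → ℝ} (hf : IsLip f) {a b m : ℝ} (ha : 0 < a) (hab : a ≤ b)
    (hm : ∀ s ∈ Icc a b, m ≤ I s) :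
    ENNReal.ofReal (m * (fnRearrReal μ f a - fnRearrReal μ f b)) ≤
      ∫⁻ x in {x | fnRearr μ f b < ‖f x‖ₑ ∧ ‖f x‖ₑ < fnRearr μ f a}, gradMod f x ∂μ := by
  have hfm := hf.continuous.measurable
  set A := fnRearrReal μ f a with hA
  set B := fnRearrReal μ f b with hB
  have hA' : ENNReal.ofReal A = fnRearr μ f a := ofReal_fnRearrReal μ hfm ha
  have hB' : ENNReal.ofReal B = fnRearr μ f b := ofReal_fnRearrReal μ hfm (ha.trans_le hab)
  have hB0 : 0 ≤ B := ENNReal.toReal_nonneg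
  have hBA : B ≤ A := fnRearrReal_antitoneOn μ hfm ha (ha.trans_le hab : (0 : ℝ) < b) hab
  set g : Ω → ℝ := fun x => max 0 (min |f x| A - B) with hg
  have hH : ∀ x y, |g x - g y| ≤ |f x - f y| := fun x y => abs_trunc_sub_le A B (f x) (f y)
  have hglip : IsLip g := hf.of_le' fun x y => by
    rw [Real.enorm_eq_ofReal_abs, Real.enorm_eq_ofReal_abs]
    exact ENNReal.ofReal_le_ofReal (hH x y)
  have hen : ∀ x, ‖f x‖ₑ = ENNReal.ofReal |f x| := fun x => Real.enorm_eq_ofReal_abs _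
  refine le_trans ?_ ((h g hglip).trans (hgrad.lintegral_le hf hH (c₁ := 0) (c₂ := A - B)
    (hf.measurableSet_band _ _) fun x hx => ?_))
  · calc ENNReal.ofReal (m * (A - B)) = ∫⁻ _ in Ioo 0 (A - B), ENNReal.ofReal m := by
          rw [setLIntegral_const, Real.volume_Ioo, sub_zero,
            ENNReal.ofReal_mul' (sub_nonneg.2 hBA)]
      _ ≤ ∫⁻ s in Ioo 0 (A - B),
          ENNReal.ofReal (I (distrib μ (fun x => ‖g x‖ₑ) (ENNReal.ofReal s)).toReal) := by
          refine setLIntegral_mono' measurableSet_Ioo fun s hs => ENNReal.ofReal_le_ofReal (hm _ ?_)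
          have hset : {x | s < |g x|} = {x | B + s < |f x|} := by
            ext x
            have : 0 ≤ g x := le_max_left _ _
            rw [mem_ofPred_eq, abs_of_nonneg this]
            simp only [mem_ofPred_eq, hg, lt_max_iff, not_lt.2 hs.1.le,
              false_or, lt_sub_iff_add_lt, lt_min_iff]
            constructor
            · rintro ⟨h1, -⟩
              linarith
            · intro h1
              exact ⟨by linarith, by linarith [hs.2]⟩
          rw [distrib_enorm μ g hs.1.le, hset,
            ← distrib_enorm μ f (add_nonneg hB0 hs.1.le)]
          have hfin : distrib μ (fun x => ‖f x‖ₑ) (ENNReal.ofReal (B + s)) ≠ ∞ :=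
            measure_ne_top _ _
          constructor
          · refine (ENNReal.ofReal_le_iff_le_toReal hfin).1 ((lt_rearr_iff μ _).1 ?_).le
            change _ < fnRearr μ f a
            rw [← hA', ENNReal.ofReal_lt_ofReal_iff_of_nonneg (add_nonneg hB0 hs.1.le)]
            linarith [hs.2]
          · refine ENNReal.toReal_le_of_le_ofReal (ha.le.trans hab) (distrib_le_of_rearr_le μ _ ?_)
            change fnRearr μ f b ≤ _
            rw [← hB']
            exact ENNReal.ofReal_le_ofReal (by linarith [hs.1])
      _ ≤ _ := lintegral_mono_set fun s hs => hs.1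
  · rw [mem_ofPred_eq, ← hA', ← hB', hen, not_and_or, not_lt, not_lt,
      ENNReal.ofReal_le_ofReal_iff hB0, ENNReal.ofReal_le_ofReal_iff (abs_nonneg _)] at hx
    rcases hx with hx | hx
    · left
      exact max_eq_left (by linarith [min_le_left |f x| A])
    · right
      simp only [hg, min_eq_right hx]
      exact max_eq_right (by linarith)

/-- Concavity and `I 0 = 0` make `I(p) / p` decreasing. -/
theorem IsProfileShape.le_div_mul (hI : IsProfileShape I) {p t : ℝ} (hp : 0 ≤ p) (hpt : p ≤ t)
    (ht : t ∈ Ioo (0 : ℝ) 1) : p ≤ t / I t * I p := by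
  have h0 : (0 : ℝ) ∈ Icc (0 : ℝ) 1 := by simp
  have h1 := hI.concaveOn.2 (⟨ht.1.le, ht.2.le⟩ : t ∈ Icc (0 : ℝ) 1) h0
    (div_nonneg hp ht.1.le) (sub_nonneg.2 ((div_le_one ht.1).2 hpt)) (by ring)
  have hpos := hI.pos t ht
  simp only [smul_eq_mul, hI.zero, mul_zero, add_zero, div_mul_cancel₀ p ht.1.ne'] at h1
  rw [div_mul_eq_mul_div, le_div_iff₀ hpos]
  rw [div_mul_eq_mul_div, div_le_iff₀ ht.1] at h1
  linarith

theorem LedouxInequality.oscillation (hI : IsProfileShape I) (h : LedouxInequality μ I)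
    (hgrad : GradVanishesOnLevels μ) : OscillationInequality μ I := by
  intro f hf t ht
  have hfm := hf.continuous.measurable
  have ht0 : ENNReal.ofReal t ≠ 0 := by simpa using ht.1
  set k := fnRearrReal μ f t with hk
  have hk' : ENNReal.ofReal k = fnRearr μ f t := ofReal_fnRearrReal μ hfm ht.1
  have hk0 : 0 ≤ k := ENNReal.toReal_nonneg
  set g : Ω → ℝ := fun x => max 0 (|f x| - k) with hg
  have hg0 : ∀ x, 0 ≤ g x := fun x => le_max_left _ _
  have hH : ∀ x y, |g x - g y| ≤ |f x - f y| := fun x y => abs_posPart_sub_le k (f x) (f y)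
  have hglip : IsLip g := hf.of_le' fun x y => by
    rw [Real.enorm_eq_ofReal_abs, Real.enorm_eq_ofReal_abs]
    exact ENNReal.ofReal_le_ofReal (hH x y)
  have hS : MeasurableSet {x | fnRearr μ f t < ‖f x‖ₑ} :=
    measurableSet_lt measurable_const hfm.enorm
  have hSt : μ {x | fnRearr μ f t < ‖f x‖ₑ} ≤ ENNReal.ofReal t :=
    distrib_le_of_rearr_le μ _ le_rfl
  have h1 : ∫⁻ x, gradMod g x ∂μ ≤ ∫⁻ s in Ioo 0 t, rearr μ (gradMod f) s := by
    refine (hgrad.lintegral_le hf hH (c₁ := 0) (c₂ := 0) hS fun x hx => ?_).trans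
      (setLIntegral_le_lintegral_rearr μ (measurable_gradMod hf.continuous).aemeasurable hSt)
    rw [mem_ofPred_eq, ← hk', Real.enorm_eq_ofReal_abs, not_lt,
      ENNReal.ofReal_le_ofReal_iff hk0] at hx
    exact Or.inl (max_eq_left (by linarith))
  have h2 : ∫⁻ x, (‖f x‖ₑ - fnRearr μ f t) ∂μ ≤
      ENNReal.ofReal (t / I t) * ∫⁻ s in Ioo 0 t, rearr μ (gradMod f) s := by
    calc ∫⁻ x, (‖f x‖ₑ - fnRearr μ f t) ∂μ = ∫⁻ x, ENNReal.ofReal (g x) ∂μ := by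
          refine lintegral_congr fun x => ?_
          rw [← hk', Real.enorm_eq_ofReal_abs, ← ENNReal.ofReal_sub _ hk0]
          simp [hg, ENNReal.ofReal_max]
      _ = ∫⁻ s in Ioi (0 : ℝ), μ {x | s < g x} :=
          lintegral_eq_lintegral_meas_lt μ (.of_forall hg0)
            hglip.continuous.measurable.aemeasurable
      _ ≤ ∫⁻ s in Ioi (0 : ℝ), ENNReal.ofReal (t / I t) *
          ENNReal.ofReal (I (distrib μ (fun x => ‖g x‖ₑ) (ENNReal.ofReal s)).toReal) := by
          refine setLIntegral_mono' measurableSet_Ioi fun s hs => ?_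
          have hs0 : (0 : ℝ) ≤ s := le_of_lt hs
          rw [distrib_enorm μ g hs0]
          simp only [abs_of_nonneg (hg0 _)]
          have hle : μ {x | s < g x} ≤ ENNReal.ofReal t := by
            refine (measure_mono fun x hx => ?_).trans hSt
            rw [mem_ofPred_eq, ← hk', Real.enorm_eq_ofReal_abs,
              ENNReal.ofReal_lt_ofReal_iff_of_nonneg hk0]
            have hx' : s < max 0 (|f x| - k) := hx
            rcases lt_max_iff.1 hx' with h3 | h3
            · exact absurd h3 (not_lt.2 hs0)
            · linarith
          rw [← ENNReal.ofReal_mul (div_nonneg ht.1.le (hI.pos t ht).le)]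
          refine (ENNReal.ofReal_toReal (measure_ne_top μ {x | s < g x})).symm.trans_le ?_
          exact ENNReal.ofReal_le_ofReal (hI.le_div_mul ENNReal.toReal_nonneg
            (ENNReal.toReal_le_of_le_ofReal ht.1.le hle) ht)
      _ = ENNReal.ofReal (t / I t) * ∫⁻ s in Ioi (0 : ℝ),
          ENNReal.ofReal (I (distrib μ (fun x => ‖g x‖ₑ) (ENNReal.ofReal s)).toReal) :=
          lintegral_const_mul' _ _ ENNReal.ofReal_ne_top
      _ ≤ _ := mul_le_mul_right ((h g hglip).trans h1) _
  -- Here `t (f^{**}(t) - f^*(t)) = ∫ (|f| - f^*(t))⁺`, so `h2` is the claim multiplied by `t`.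
  rw [tsub_le_iff_right, rearrAvg, rearrAvg, lintegral_rearr_eq μ hfm.enorm.aemeasurable,
    ENNReal.add_div, mul_comm (ENNReal.ofReal t), ENNReal.mul_div_cancel_right ht0
    ENNReal.ofReal_ne_top, add_comm, ← mul_div_assoc]
  exact add_le_add (ENNReal.div_le_div_right h2 _) le_rfl

/-! ### Differentiation of additive interval functions with infinite values -/

section IntervalFunctions

/-- A `[0, ∞]`-valued additive function of intervals has a two-sided derivative in `[0, ∞]` at
almost every point. -/
theorem ae_exists_deriv_of_additive {J : ℝ → ℝ → ℝ≥0∞}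
    (hJ : ∀ a b c, a ≤ b → b ≤ c → J a b + J b c = J a c) :
    ∀ᵐ s : ℝ, ∃ D : ℝ≥0∞,
      Tendsto (fun h : ℝ => J s (s + h) / ENNReal.ofReal h) (𝓝[>] 0) (𝓝 D) ∧
      Tendsto (fun h : ℝ => J (s - h) s / ENNReal.ofReal h) (𝓝[>] 0) (𝓝 D) := by
  have hmono : ∀ {a b c d : ℝ}, a ≤ b → b ≤ c → c ≤ d → J b c ≤ J a d := by
    intro a b c d hab hbc hcd
    rw [← hJ a c d (hab.trans hbc) hcd, ← hJ a b c hab hbc]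
    exact le_add_self.trans le_self_add
  -- Points with finite `J` on some interval to their left, respectively right. Finiteness on one
  -- side of `s` passes to both sides of all nearby points on that side, so a fixed rational
  -- endpoint allows at most one point in `R \ L` or `L \ R`. Both differences are therefore
  -- countable.
  set L : Set ℝ := {s | ∃ p : ℚ, p < s ∧ J p s ≠ ∞} with hL
  set R : Set ℝ := {s | ∃ q : ℚ, s < q ∧ J s q ≠ ∞} with hR
  have hRL : (R \ L).Countable := by
    have : R \ L ⊆ ⋃ q : ℚ, {s | s < q ∧ J s q ≠ ∞ ∧ s ∉ L} := by
      rintro s ⟨⟨q, hq, hq'⟩, hs⟩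
      exact mem_iUnion.2 ⟨q, hq, hq', hs⟩
    refine (countable_iUnion fun q => Set.Subsingleton.countable ?_).mono this
    have key : ∀ s s' : ℝ, s < s' → s' < q → J s q ≠ ∞ → s' ∈ L := by
      intro s s' hss' hs'q hfin
      obtain ⟨p, hp, hp'⟩ := exists_rat_btwn hss'
      exact ⟨p, hp', ne_top_of_le_ne_top hfin (hmono hp.le hp'.le hs'q.le)⟩
    rintro s ⟨h1, h2, h3⟩ s' ⟨h1', h2', h3'⟩
    rcases lt_trichotomy s s' with h | h | h
    · exact absurd (key s s' h h1' h2) h3'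
    · exact h
    · exact absurd (key s' s h h1 h2') h3
  have hLR : (L \ R).Countable := by
    have : L \ R ⊆ ⋃ p : ℚ, {s | p < s ∧ J p s ≠ ∞ ∧ s ∉ R} := by
      rintro s ⟨⟨q, hq, hq'⟩, hs⟩
      exact mem_iUnion.2 ⟨q, hq, hq', hs⟩
    refine (countable_iUnion fun p => Set.Subsingleton.countable ?_).mono this
    have key : ∀ s s' : ℝ, p < s → s < s' → J p s' ≠ ∞ → s ∈ R := by
      intro s s' hps hss' hfin
      obtain ⟨q, hq, hq'⟩ := exists_rat_btwn hss'
      exact ⟨q, hq, ne_top_of_le_ne_top hfin (hmono hps.le hq.le hq'.le)⟩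
    rintro s ⟨h1, h2, h3⟩ s' ⟨h1', h2', h3'⟩
    rcases lt_trichotomy s s' with h | h | h
    · exact absurd (key s s' h1 h h2') h3
    · exact h
    · exact absurd (key s' s h1' h h2) h3'
  have hdiff : ∀ᵐ s : ℝ, ∀ p q : ℚ, J p q ≠ ∞ → s ∈ Ioo (p : ℝ) q →
      DifferentiableAt ℝ (fun s => (J p s).toReal) s := by
    rw [ae_all_iff]; intro p
    rw [ae_all_iff]; intro q
    by_cases hfin : J p q = ∞
    · simp [hfin]
    have hm : MonotoneOn (fun s => (J p s).toReal) (Ioo (p : ℝ) q) := fun a ha b hb hab =>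
      ENNReal.toReal_mono (ne_top_of_le_ne_top hfin (hmono le_rfl hb.1.le hb.2.le))
        (hmono le_rfl ha.1.le hab)
    filter_upwards [hm.ae_differentiableWithinAt_of_mem] with s hs _ hs'
    exact (hs hs').differentiableAt (Ioo_mem_nhds hs'.1 hs'.2)
  filter_upwards [hRL.ae_notMem volume, hLR.ae_notMem volume, hdiff] with s h1 h2 h3
  by_cases hs : s ∈ R
  · have hs' : s ∈ L := by
      by_contra h
      exact h1 ⟨hs, h⟩
    obtain ⟨q, hsq, hq⟩ := hs
    obtain ⟨p, hps, hp⟩ := hs'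
    have hpq : J p q ≠ ∞ := by
      rw [← hJ p s q hps.le hsq.le]
      exact ENNReal.add_ne_top.2 ⟨hp, hq⟩
    have hd := (h3 p q hpq ⟨hps, hsq⟩).hasDerivAt
    -- With finite `J` around `s`, its values are increments of a monotone real function, and
    -- Lebesgue's differentiation theorem applies.
    set F : ℝ → ℝ := fun s => (J p s).toReal with hF
    have hval : ∀ a b : ℝ, p ≤ a → a ≤ b → b ≤ q → J a b = ENNReal.ofReal (F b - F a) := by
      intro a b ha hab hb
      have hab' : J a b ≠ ∞ := ne_top_of_le_ne_top hpq (hmono ha hab hb)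
      have hpa : J p a ≠ ∞ := ne_top_of_le_ne_top hpq (hmono le_rfl ha (hab.trans hb))
      simp only [hF]
      rw [← hJ p a b ha hab, ENNReal.toReal_add hpa hab', add_sub_cancel_left,
        ENNReal.ofReal_toReal hab']
    refine ⟨ENNReal.ofReal (deriv F s), ?_, ?_⟩
    · refine (ENNReal.tendsto_ofReal hd.tendsto_slope_zero_right).congr' ?_
      filter_upwards [Ioo_mem_nhdsGT (sub_pos.2 hsq)] with h hh
      rw [hval s (s + h) hps.le (by linarith [hh.1]) (by linarith [hh.2]), smul_eq_mul,
        ← ENNReal.ofReal_div_of_pos hh.1, inv_mul_eq_div]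
    · have hneg : Tendsto (fun h : ℝ => -h) (𝓝[>] 0) (𝓝[<] 0) := by
        simpa using tendsto_neg_nhdsGT (a := (0 : ℝ))
      refine ((ENNReal.tendsto_ofReal hd.tendsto_slope_zero_left).comp hneg).congr' ?_
      filter_upwards [Ioo_mem_nhdsGT (sub_pos.2 hps)] with h hh
      rw [hval (s - h) s (by linarith [hh.2]) (by linarith [hh.1]) hsq.le,
        ← ENNReal.ofReal_div_of_pos hh.1, Function.comp_apply, smul_eq_mul, inv_neg, neg_mul,
        inv_mul_eq_div, ← sub_eq_add_neg, ← neg_div, neg_sub]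
  -- Here `J` is infinite on every interval abutting `s` from either side, so all quotients equal
  -- `∞`.
  · have hs' : s ∉ L := fun h => h2 ⟨h, hs⟩
    refine ⟨∞, ?_, ?_⟩
    · refine tendsto_const_nhds.congr' ?_
      filter_upwards [self_mem_nhdsWithin] with h (hh : 0 < h)
      have : J s (s + h) = ∞ := by
        by_contra hfin
        obtain ⟨q, hq, hq'⟩ := exists_rat_btwn (lt_add_of_pos_right s hh)
        exact hs ⟨q, hq, ne_top_of_le_ne_top hfin (hmono le_rfl hq.le hq'.le)⟩
      rw [this, ENNReal.top_div_of_ne_top ENNReal.ofReal_ne_top]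
    · refine tendsto_const_nhds.congr' ?_
      filter_upwards [self_mem_nhdsWithin] with h (hh : 0 < h)
      have : J (s - h) s = ∞ := by
        by_contra hfin
        obtain ⟨p, hp, hp'⟩ := exists_rat_btwn (sub_lt_self s hh)
        exact hs' ⟨p, hp', ne_top_of_le_ne_top hfin (hmono hp.le hp'.le le_rfl)⟩
      rw [this, ENNReal.top_div_of_ne_top ENNReal.ofReal_ne_top]

end IntervalFunctions

theorem ae_differentiableAt_fnRearrReal {α : Type*} [MeasurableSpace α] (ν : Measure α)
    [IsProbabilityMeasure ν] {f : α → ℝ} (hf : Measurable f) :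
    ∀ᵐ s ∂(volume.restrict (Ioo (0 : ℝ) 1)), DifferentiableAt ℝ (fnRearrReal ν f) s := by
  rw [ae_restrict_iff' measurableSet_Ioo]
  have hm : MonotoneOn (-fnRearrReal ν f) (Ioi 0) := (fnRearrReal_antitoneOn ν hf).neg
  filter_upwards [hm.ae_differentiableWithinAt_of_mem] with s hs hs'
  simpa using ((hs hs'.1).differentiableAt (Ioi_mem_nhds hs'.1)).neg

/-! ### From Ledoux to Maz'ya's inequality -/

variable {Ω : Type*} [MetricSpace Ω] [MeasurableSpace Ω] [BorelSpace Ω] {μ : Measure Ω}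

theorem setLIntegral_band_add {f : Ω → ℝ} (hf : IsLip f) (φ : Ω → ℝ≥0∞) {a b c : ℝ≥0∞}
    (hab : b ≤ a) (hbc : c ≤ b) :
    ∫⁻ x in {x | b < ‖f x‖ₑ ∧ ‖f x‖ₑ ≤ a}, φ x ∂μ + ∫⁻ x in {x | c < ‖f x‖ₑ ∧ ‖f x‖ₑ ≤ b}, φ x ∂μ =
      ∫⁻ x in {x | c < ‖f x‖ₑ ∧ ‖f x‖ₑ ≤ a}, φ x ∂μ := by
  rw [← lintegral_union (hf.measurableSet_band' _ _)]
  · congr 2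
    ext x
    simp only [mem_union, mem_ofPred_eq]
    constructor
    · rintro (h | h)
      · exact ⟨hbc.trans_lt h.1, h.2⟩
      · exact ⟨h.1, h.2.trans hab⟩
    · intro h
      rcases lt_or_ge b ‖f x‖ₑ with h' | h'
      · exact Or.inl ⟨h', h.2⟩
      · exact Or.inr ⟨h.1, h'⟩
  · rw [Set.disjoint_left]
    exact fun x h h' => absurd h.1 (not_lt.2 h'.2)

theorem levelEnergyIncr_add {f : Ω → ℝ} (hf : IsLip f) {a b c : ℝ} (hab : a ≤ b) (hbc : b ≤ c) :
    levelEnergyIncr μ f a b + levelEnergyIncr μ f b c = levelEnergyIncr μ f a c :=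
  setLIntegral_band_add hf _ (fnRearr_antitone μ f hab) (fnRearr_antitone μ f hbc)

variable [IsProbabilityMeasure μ] {I : ℝ → ℝ}

theorem LedouxInequality.mazya (hI : IsProfileShape I) (h : LedouxInequality μ I)
    (hgrad : GradVanishesOnLevels μ) : MazyaInequality μ I := by
  intro f hf
  have hfm := hf.continuous.measurable
  filter_upwards [ae_differentiableAt_fnRearrReal μ hfm, ae_restrict_mem measurableSet_Ioo,
    ae_restrict_of_ae (ae_exists_deriv_of_additive (J := levelEnergyIncr μ f)
      fun a b c hab hbc => levelEnergyIncr_add hf hab hbc)] with s hs hs01 ⟨D, hD1, hD2⟩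
  refine ⟨_, D, hs.hasDerivAt, ⟨hD1, hD2⟩, ?_⟩
  set f' := deriv (fnRearrReal μ f) s with hf'
  have hcont : ContinuousAt I s := hI.continuousOn.continuousAt (Icc_mem_nhds hs01.1 hs01.2)
  -- By continuity `I ≥ m` on a short interval `[s, s + r]`, so the band estimate divided by `r`
  -- gives the bound with `m`. Then `m` increases to `I s`.
  have key : ∀ m < I s, ENNReal.ofReal (-f' * m) ≤ D := by
    intro m hm
    have hslope := hs.hasDerivAt.tendsto_slope_zero_right
    refine le_of_tendsto_of_tendsto (ENNReal.tendsto_ofReal ((hslope.neg).mul_const m)) hD1 ?_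
    obtain ⟨δ, hδ, hball⟩ := Metric.eventually_nhds_iff.1 (hcont.eventually (lt_mem_nhds hm))
    filter_upwards [Ioo_mem_nhdsGT hδ] with r hr
    have hle : ∀ y ∈ Icc s (s + r), m ≤ I y := fun y hy => (hball (by
      rw [Real.dist_eq, abs_of_nonneg (by linarith [hy.1])]
      linarith [hy.2, hr.2])).le
    have h1 := (h.mul_sub_le hgrad hf hs01.1 (le_add_of_nonneg_right hr.1.le) hle).trans
      (lintegral_mono_set (t := {x | fnRearr μ f (s + r) < ‖f x‖ₑ ∧ ‖f x‖ₑ ≤ fnRearr μ f s})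
        fun x hx => ⟨hx.1, hx.2.le⟩)
    rw [smul_eq_mul, show -(r⁻¹ * (fnRearrReal μ f (s + r) - fnRearrReal μ f s)) * m =
      m * (fnRearrReal μ f s - fnRearrReal μ f (s + r)) / r by ring, ENNReal.ofReal_div_of_pos hr.1]
    exact ENNReal.div_le_div_right h1 _
  have hlim : Tendsto (fun m => ENNReal.ofReal (-f' * m)) (𝓝[<] (I s))
      (𝓝 (ENNReal.ofReal (-f' * I s))) :=
    ENNReal.tendsto_ofReal ((tendsto_id.mono_left nhdsWithin_le_nhds).const_mul _)
  exact le_of_tendsto hlim (by filter_upwards [self_mem_nhdsWithin] with m hm using key m hm)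

/-! ### From Maz'ya to the Pólya–Szegő inequality -/

theorem setLIntegral_rnDeriv_stieltjesFunction_le {E : ℝ → ℝ} (hE : Monotone E) {M : ℝ}
    (h : ∀ s, E s ∈ Icc 0 M) (a b : ℝ) :
    ∫⁻ s in Ioo a b, hE.stieltjesFunction.measure.rnDeriv volume s ≤ ENNReal.ofReal M := by
  -- Only the absolutely continuous part of the Stieltjes measure is integrated, so its mass bounds
  -- the integral. The right limit at `b` is controlled by the value at `b + 1`.
  refine (Measure.setLIntegral_rnDeriv_le _).trans ((measure_mono Ioo_subset_Ioc_self).trans ?_)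
  rw [StieltjesFunction.measure_Ioc, hE.stieltjesFunction_eq, hE.stieltjesFunction_eq]
  refine ENNReal.ofReal_le_ofReal ?_
  have h1 := hE.rightLim_le (lt_add_one b)
  have h2 := hE.le_rightLim (le_refl a)
  linarith [(h (b + 1)).2, (h a).1]

variable {Ω : Type*} [MetricSpace Ω] [MeasurableSpace Ω] [BorelSpace Ω] {μ : Measure Ω}
  [IsProbabilityMeasure μ] {I : ℝ → ℝ}

theorem IsProfileShape.aemeasurable_deriv_mul (hI : IsProfileShape I) (F : ℝ → ℝ) :
    AEMeasurable (fun r => ‖-deriv F r * I r‖ₑ) (volume.restrict (Ioo (0 : ℝ) 1)) :=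
  ((measurable_deriv F).neg.aemeasurable.mul ((hI.continuousOn.mono Ioo_subset_Icc_self).aemeasurable
    measurableSet_Ioo)).enorm

theorem GradVanishesOnLevels.levelEnergyIncr_le_add (hgrad : GradVanishesOnLevels μ) {f : Ω → ℝ}
    (hf : IsLip f) (k : ℝ≥0∞) {a b : ℝ} (ha : 0 ≤ a) (ha' : a ≤ 1) :
    levelEnergyIncr μ f a b ≤
      ∫⁻ x in {x | fnRearr μ f b < ‖f x‖ₑ ∧ ‖f x‖ₑ ≤ fnRearr μ f a}, (gradMod f x - k) ∂μ +
        k * ENNReal.ofReal (b - a) := by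
  calc levelEnergyIncr μ f a b
      ≤ ∫⁻ x in {x | fnRearr μ f b < ‖f x‖ₑ ∧ ‖f x‖ₑ < fnRearr μ f a}, gradMod f x ∂μ :=
        hgrad.levelEnergyIncr_le hf a b
    _ ≤ ∫⁻ x in {x | fnRearr μ f b < ‖f x‖ₑ ∧ ‖f x‖ₑ < fnRearr μ f a},
          ((gradMod f x - k) + k) ∂μ := lintegral_mono fun x => le_tsub_add
    _ = ∫⁻ x in {x | fnRearr μ f b < ‖f x‖ₑ ∧ ‖f x‖ₑ < fnRearr μ f a}, (gradMod f x - k) ∂μ +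
          k * μ {x | fnRearr μ f b < ‖f x‖ₑ ∧ ‖f x‖ₑ < fnRearr μ f a} := by
        rw [lintegral_add_right _ measurable_const, setLIntegral_const]
    _ ≤ _ := add_le_add (lintegral_mono_set
          (t := {x | fnRearr μ f b < ‖f x‖ₑ ∧ ‖f x‖ₑ ≤ fnRearr μ f a}) fun x hx => ⟨hx.1, hx.2.le⟩)
        (mul_le_mul_right (measure_band_le μ hf.continuous.measurable.enorm ha ha') _)

/-- Let `E(s)` be the integral of `(|∇f| - k)⁺` over `{|f| > f^*(s)}`. The energy derivative in
Maz'ya's inequality is at most `E' + k`, and the integral of `E'` is at most the total variation of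
the monotone function `E`. -/
theorem MazyaInequality.lintegral_tsub_le (hI : IsProfileShape I) (h : MazyaInequality μ I)
    (hgrad : GradVanishesOnLevels μ) {f : Ω → ℝ} (hf : IsLip f) (k : ℝ≥0∞) :
    ∫⁻ r in Ioo (0 : ℝ) 1, (‖-deriv (fnRearrReal μ f) r * I r‖ₑ - k) ≤
      ∫⁻ x, (gradMod f x - k) ∂μ := by
  set M := ∫⁻ x, (gradMod f x - k) ∂μ with hM
  rcases eq_or_ne M ∞ with htop | htop
  · simp [htop]
  let e : ℝ → ℝ≥0∞ := fun s => ∫⁻ x in {x | fnRearr μ f s < ‖f x‖ₑ}, (gradMod f x - k) ∂μ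
  have heM : ∀ s, e s ≤ M := fun s => setLIntegral_le_lintegral _ _
  have hefin : ∀ s, e s ≠ ∞ := fun s => ne_top_of_le_ne_top htop (heM s)
  let E : ℝ → ℝ := fun s => (e s).toReal
  have hE : Monotone E := fun a b hab => ENNReal.toReal_mono (hefin b)
    (lintegral_mono_set fun x hx => lt_of_le_of_lt (fnRearr_antitone μ f hab) hx)
  have hincr : ∀ a b, a ≤ b →
      ∫⁻ x in {x | fnRearr μ f b < ‖f x‖ₑ ∧ ‖f x‖ₑ ≤ fnRearr μ f a}, (gradMod f x - k) ∂μ =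
        ENNReal.ofReal (E b - E a) := by
    intro a b hab
    have h1 := setLIntegral_band_add (μ := μ) hf (fun x => gradMod f x - k)
      (le_top : fnRearr μ f a ≤ ∞) (fnRearr_antitone μ f hab)
    simp only [le_top, and_true] at h1
    change e a + _ = e b at h1
    have h2 : ∫⁻ x in {x | fnRearr μ f b < ‖f x‖ₑ ∧ ‖f x‖ₑ ≤ fnRearr μ f a},
        (gradMod f x - k) ∂μ ≠ ∞ := ne_top_of_le_ne_top (hefin b) (h1 ▸ le_add_self)
    simp only [E]
    rw [← h1, ENNReal.toReal_add (hefin a) h2, add_sub_cancel_left, ENNReal.ofReal_toReal h2]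
  have hEM : ∀ s, E s ∈ Icc 0 M.toReal := fun s =>
    ⟨ENNReal.toReal_nonneg, ENNReal.toReal_mono htop (heM s)⟩
  refine le_trans (lintegral_mono_ae ?_)
    ((setLIntegral_rnDeriv_stieltjesFunction_le hE hEM 0 1).trans ENNReal.ofReal_toReal_le)
  filter_upwards [h f hf, ae_restrict_of_ae hE.ae_hasDerivAt, ae_restrict_mem measurableSet_Ioo]
    with s ⟨f', D, hf', hD, hle⟩ hEs hs
  rw [hf'.deriv]
  -- The sign turns the absolute value `|-f' I|` into the quantity `-f' I` of Maz'ya's inequality.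
  have hneg : f' ≤ 0 := by
    refine le_of_tendsto hf'.tendsto_slope_zero_right ?_
    filter_upwards [self_mem_nhdsWithin] with r (hr : 0 < r)
    rw [smul_eq_mul]
    exact mul_nonpos_of_nonneg_of_nonpos (inv_nonneg.2 hr.le) (sub_nonpos.2
      (fnRearrReal_antitoneOn μ hf.continuous.measurable hs.1 (add_pos hs.1 hr)
        (le_add_of_nonneg_right hr.le)))
  rw [Real.enorm_of_nonneg (mul_nonneg (neg_nonneg.2 hneg) (hI.pos s hs).le), tsub_le_iff_right]
  refine hle.trans (le_trans ?_ (add_le_add_left ENNReal.ofReal_toReal_le k))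
  refine le_of_tendsto_of_tendsto hD.1
    ((ENNReal.tendsto_ofReal hEs.tendsto_slope_zero_right).add tendsto_const_nhds) ?_
  filter_upwards [self_mem_nhdsWithin] with r (hr : 0 < r)
  refine ENNReal.div_le_of_le_mul ?_
  have h1 := hgrad.levelEnergyIncr_le_add hf k hs.1.le hs.2.le (b := s + r)
  rw [hincr s (s + r) (le_add_of_nonneg_right hr.le), add_sub_cancel_left] at h1
  rwa [add_mul, ← ENNReal.ofReal_mul' hr.le, smul_eq_mul, mul_comm _ r, mul_inv_cancel_left₀ hr.ne']

/-- The level `k = |∇f|^*(t)` is optimal on the right, while on the left any `k` gives an upper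
bound. -/
theorem MazyaInequality.polyaSzego (hI : IsProfileShape I) (h : MazyaInequality μ I)
    (hgrad : GradVanishesOnLevels μ) : PolyaSzegoInequality μ I := by
  intro f hf t _
  rw [lintegral_rearr_eq μ (measurable_gradMod hf.continuous).aemeasurable]
  exact (lintegral_rearr_le _ (hI.aemeasurable_deriv_mul _) t _).trans
    (add_le_add_right (h.lintegral_tsub_le hI hgrad hf _) _)

/-! ### Lipschitz approximations of indicator functions -/

section TestFunctions

variable {Ω : Type*} [MetricSpace Ω]

/-- The Lipschitz approximation of the indicator function of `A` which vanishes outside the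
`r`-neighbourhood of `A`. -/
noncomputable def bump (A : Set Ω) (r : ℝ) (x : Ω) : ℝ :=
  max 0 (1 - Metric.infDist x A / r)

theorem bump_nonneg (A : Set Ω) (r : ℝ) (x : Ω) : 0 ≤ bump A r x := le_max_left _ _

theorem bump_eq_one {A : Set Ω} (r : ℝ) {x : Ω} (hx : x ∈ A) : bump A r x = 1 := by
  simp [bump, Metric.infDist_zero_of_mem hx]

theorem bump_pos_iff {A : Set Ω} (hA : A.Nonempty) {r : ℝ} (hr : 0 < r) {x : Ω} :
    0 < bump A r x ↔ x ∈ Metric.thickening r A := by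
  rw [bump, Metric.mem_thickening_iff, ← Metric.infDist_lt_iff hA]
  simp [div_lt_one hr]

theorem lipschitzWith_bump (A : Set Ω) {r : ℝ} (hr : 0 < r) :
    LipschitzWith (1 / r).toNNReal (bump A r) := by
  refine LipschitzWith.of_dist_le_mul fun x y => ?_
  rw [Real.dist_eq, Real.coe_toNNReal _ (by positivity)]
  refine (abs_max_sub_max_le_max _ _ _ _).trans (max_le (by simp; positivity) ?_)
  rw [sub_sub_sub_cancel_left, ← sub_div, abs_div, abs_of_pos hr, div_mul_eq_mul_div, one_mul]
  gcongr
  have := (Metric.lipschitz_infDist_pt A).dist_le_mul y x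
  rwa [NNReal.coe_one, one_mul, dist_comm y x, Real.dist_eq] at this

variable [MeasurableSpace Ω] {μ : Measure Ω}

theorem one_le_fnRearr_bump {A : Set Ω} (r : ℝ) {s : ℝ} (hs : ENNReal.ofReal s < μ A) :
    1 ≤ fnRearr μ (bump A r) s := by
  refine le_of_forall_lt fun τ hτ => (lt_rearr_iff μ _).2 (hs.trans_le (measure_mono fun x hx => ?_))
  simpa [bump_eq_one r hx] using hτ

theorem fnRearr_bump_eq_zero {A : Set Ω} (hA : A.Nonempty) {r : ℝ} (hr : 0 < r) {s : ℝ}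
    (hs : μ (Metric.thickening r A) ≤ ENNReal.ofReal s) : fnRearr μ (bump A r) s = 0 := by
  refine le_antisymm (sInf_le ((measure_mono fun x hx => ?_).trans hs)) bot_le
  have h0 : bump A r x ≠ 0 := by simpa using hx
  exact (bump_pos_iff hA hr).1 ((bump_nonneg A r x).lt_of_ne h0.symm)

variable [BorelSpace Ω] [IsProbabilityMeasure μ]

/-- The gradient is at most `1 / r`. It vanishes a.e. on `A` and off the neighbourhood, which lie in
the levels `1` and `0`. -/
theorem GradVanishesOnLevels.lintegral_bump_le (hgrad : GradVanishesOnLevels μ) {A : Set Ω}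
    (hAm : MeasurableSet A) (hA : A.Nonempty) {r : ℝ} (hr : 0 < r) :
    ∫⁻ x, gradMod (bump A r) x ∂μ ≤
      (μ (Metric.thickening r A) - μ A) / ENNReal.ofReal r := by
  have hlip := lipschitzWith_bump A hr
  have hm : MeasurableSet (Metric.thickening r A \ A) :=
    Metric.isOpen_thickening.measurableSet.diff hAm
  rw [← measure_sdiff (Metric.self_subset_thickening hr A) hAm.nullMeasurableSet
    (measure_ne_top _ _), div_eq_mul_inv, mul_comm, ← ENNReal.ofReal_inv_of_pos hr,
    ← setLIntegral_const, ← lintegral_indicator hm]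
  refine lintegral_mono_ae ?_
  filter_upwards [hgrad _ (isLip_of_lipschitzWith hlip) 0, hgrad _ (isLip_of_lipschitzWith hlip) 1]
    with x h0 h1
  by_cases hx : x ∈ Metric.thickening r A \ A
  · rw [indicator_of_mem hx]
    refine (gradMod_le_of_lipschitz hlip x).trans_eq ?_
    rw [one_div]
    rfl
  · have : gradMod (bump A r) x = 0 := by
      by_cases hxA : x ∈ A
      · exact h1 (bump_eq_one r hxA)
      · refine h0 (le_antisymm (not_lt.1 fun h => hx ⟨(bump_pos_iff hA hr).1 h, hxA⟩)
          (bump_nonneg A r x))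
    rw [this]
    exact bot_le

end TestFunctions

/-! ### Return to the isoperimetric inequality -/

variable {Ω : Type*} [MetricSpace Ω] [MeasurableSpace Ω] {μ : Measure Ω} [IsProbabilityMeasure μ]
  {I : ℝ → ℝ}

/-- To bound the perimeter of `A` from below it is enough to consider neighbourhoods whose measure
is close to that of `A`. -/
theorem ofReal_le_perimeter {A : Set Ω} {b C : ℝ} (hb : (μ A).toReal < b)
    (H : ∀ r, 0 < r → μ (Metric.thickening r A) ≤ ENNReal.ofReal b →
      ENNReal.ofReal C ≤ (μ (Metric.thickening r A) - μ A) / ENNReal.ofReal r) :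
    ENNReal.ofReal C ≤ perimeter μ A := by
  refine le_liminf_of_le (by isBoundedDefault) ?_
  -- When `μ(A_r) ≥ b` the quotient is at least `(b - μ(A)) / r`, which exceeds `C` for small `r`.
  have hlim : Tendsto (fun r : ℝ => C * r) (𝓝[>] 0) (𝓝 0) := by
    simpa using ((tendsto_id (x := 𝓝 (0 : ℝ))).mono_left nhdsWithin_le_nhds).const_mul C
  filter_upwards [self_mem_nhdsWithin, hlim.eventually (gt_mem_nhds (sub_pos.2 hb))]
    with r (hr : 0 < r) hr'
  rcases le_total (μ (Metric.thickening r A)) (ENNReal.ofReal b) with h | h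
  · exact H r hr h
  · rw [ENNReal.le_div_iff_mul_le (Or.inl (by simpa using hr)) (Or.inl ENNReal.ofReal_ne_top),
      ← ENNReal.ofReal_mul' hr.le]
    calc ENNReal.ofReal (C * r) ≤ ENNReal.ofReal (b - (μ A).toReal) :=
          ENNReal.ofReal_le_ofReal hr'.le
      _ = ENNReal.ofReal b - μ A := by
          rw [ENNReal.ofReal_sub _ ENNReal.toReal_nonneg, ENNReal.ofReal_toReal (measure_ne_top _ _)]
      _ ≤ _ := tsub_le_tsub_right h _

theorem IsProfileShape.isoperimetricInequality_of_nontrivial (hI : IsProfileShape I)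
    (H : ∀ A : Set Ω, MeasurableSet A → A.Nonempty → (μ A).toReal ∈ Ioo (0 : ℝ) 1 →
      ENNReal.ofReal (I (μ A).toReal) ≤ perimeter μ A) : IsoperimetricInequality μ I := by
  intro A hA
  have h01 := toReal_measure_mem_Icc μ A
  rcases h01.1.eq_or_lt with h0 | h0
  · simp [← h0, hI.zero]
  rcases h01.2.eq_or_lt with h1 | h1
  · have := hI.symm 1 (by simp)
    rw [sub_self, hI.zero] at this
    simp [h1, ← this]
  · refine H A hA (nonempty_iff_ne_empty.2 ?_) ⟨h0, h1⟩
    rintro rfl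
    simp at h0

theorem isoperimetricInequality_of_le_profile
    (h : ∀ t ∈ Icc (0 : ℝ) 1, ENNReal.ofReal (I t) ≤ profile μ t) :
    IsoperimetricInequality μ I := fun A hA =>
  (h _ (toReal_measure_mem_Icc μ A)).trans (iInf_le_of_le A (iInf_le_of_le hA (iInf_le _
    (ENNReal.ofReal_toReal (measure_ne_top μ A)).symm)))

variable [BorelSpace Ω]

/-- For `t > p = μ(A)` and `μ(A_r) ≤ t`, the test function has `f^*(t) = 0` and `f^{**}(t) ≥ p / t`,
so the difference quotient is at least `I(t) p / t`. Then `t` decreases to `p`. -/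
theorem OscillationInequality.isoperimetric (hI : IsProfileShape I)
    (h : OscillationInequality μ I) (hgrad : GradVanishesOnLevels μ) :
    IsoperimetricInequality μ I := by
  refine hI.isoperimetricInequality_of_nontrivial fun A hAm hA hp => ?_
  set p := (μ A).toReal with hpdef
  have hpA : ENNReal.ofReal p = μ A := ENNReal.ofReal_toReal (measure_ne_top _ _)
  have key : ∀ t ∈ Ioo p 1, ENNReal.ofReal (I t * (p / t)) ≤ perimeter μ A := by
    intro t ht
    have ht0 : 0 < t := hp.1.trans ht.1
    have hIt : 0 < I t := hI.pos t ⟨ht0, ht.2⟩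
    have ht0' : ENNReal.ofReal t ≠ 0 := by simpa using ht0
    refine ofReal_le_perimeter ht.1 fun r hr hrt => ?_
    have hlip := lipschitzWith_bump A hr
    have h1 := h (bump A r) (isLip_of_lipschitzWith hlip) t ⟨ht0, ht.2⟩
    rw [fnRearr_bump_eq_zero hA hr hrt, tsub_zero, rearrAvg, rearrAvg] at h1
    have h2 : ENNReal.ofReal p ≤ ∫⁻ s in Ioo 0 t, rearr μ (fun x => ‖bump A r x‖ₑ) s := by
      calc ENNReal.ofReal p = ∫⁻ _ in Ioo 0 p, 1 := by simp
        _ ≤ ∫⁻ s in Ioo 0 p, rearr μ (fun x => ‖bump A r x‖ₑ) s := by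
            refine setLIntegral_mono' measurableSet_Ioo fun s hs => one_le_fnRearr_bump r ?_
            rw [← hpA]
            exact (ENNReal.ofReal_lt_ofReal_iff hp.1).2 hs.2
        _ ≤ _ := lintegral_mono_set (Ioo_subset_Ioo_right ht.1.le)
    have h3 : ∫⁻ s in Ioo 0 t, rearr μ (gradMod (bump A r)) s ≤
        (μ (Metric.thickening r A) - μ A) / ENNReal.ofReal r :=
      (lintegral_rearr_le_lintegral μ (measurable_gradMod hlip.continuous).aemeasurable t).trans
        (hgrad.lintegral_bump_le hAm hA hr)
    set Q := (μ (Metric.thickening r A) - μ A) / ENNReal.ofReal r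
    calc ENNReal.ofReal (I t * (p / t))
        = ENNReal.ofReal (I t) * (ENNReal.ofReal p / ENNReal.ofReal t) := by
          rw [ENNReal.ofReal_mul hIt.le, ENNReal.ofReal_div_of_pos ht0]
      _ ≤ ENNReal.ofReal (I t) * (ENNReal.ofReal (t / I t) * (Q / ENNReal.ofReal t)) := by
          refine mul_le_mul_right ?_ _
          exact ((ENNReal.div_le_div_right h2 _).trans h1).trans
            (mul_le_mul_right (ENNReal.div_le_div_right h3 _) _)
      _ = Q := by
          rw [← mul_assoc, ← ENNReal.ofReal_mul hIt.le, mul_div_cancel₀ _ hIt.ne',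
            ENNReal.mul_div_cancel ht0' ENNReal.ofReal_ne_top]
  have hcont : ContinuousAt I p := hI.continuousOn.continuousAt (Icc_mem_nhds hp.1 hp.2)
  have hlim : Tendsto (fun t => ENNReal.ofReal (I t * (p / t))) (𝓝[>] p)
      (𝓝 (ENNReal.ofReal (I p))) := by
    have h1 : Tendsto (fun t => I t * (p / t)) (𝓝 p) (𝓝 (I p * (p / p))) :=
      hcont.tendsto.mul (tendsto_const_nhds.div tendsto_id hp.1.ne')
    rw [div_self hp.1.ne', mul_one] at h1
    exact ENNReal.tendsto_ofReal (h1.mono_left nhdsWithin_le_nhds)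
  refine le_of_tendsto hlim ?_
  filter_upwards [Ioo_mem_nhdsGT hp.2] with t ht using key t ht

/-- A Ledoux inequality makes the rearrangement of a Lipschitz function locally Lipschitz. -/
theorem LedouxInequality.lipschitzOnWith_fnRearrReal {P : ℝ → ℝ} (hP : IsProfileShape P)
    (h : LedouxInequality μ P) (hgrad : GradVanishesOnLevels μ) {f : Ω → ℝ} {K : ℝ≥0}
    (hf : LipschitzWith K f) {a b : ℝ} (ha : 0 < a) (hab : a ≤ b) (hb : b < 1) :
    ∃ C : ℝ≥0, LipschitzOnWith C (fnRearrReal μ f) (Icc a b) := by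
  have hfl := isLip_of_lipschitzWith hf
  have hsub : Icc a b ⊆ Icc (0 : ℝ) 1 := Icc_subset_Icc ha.le hb.le
  -- The minimum of `P` on `[a, b]` is positive. A band has energy at most `K` times its measure,
  -- which gives the constant `K / P z`.
  obtain ⟨z, hz, hmin⟩ := isCompact_Icc.exists_isMinOn (nonempty_Icc.2 hab)
    (hP.continuousOn.mono hsub)
  have hm : 0 < P z := hP.pos z ⟨ha.trans_le hz.1, hz.2.trans_lt hb⟩
  refine ⟨(K / P z).toNNReal, LipschitzOnWith.of_le_add_mul _ fun x hx y hy => ?_⟩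
  rw [Real.coe_toNNReal _ (by positivity)]
  rcases le_total y x with hyx | hxy
  · exact (fnRearrReal_antitoneOn μ hf.continuous.measurable (ha.trans_le hy.1 : (0 : ℝ) < y)
      (ha.trans_le hx.1 : (0 : ℝ) < x) hyx).trans (le_add_of_nonneg_right (by positivity))
  have h1 : ENNReal.ofReal (P z * (fnRearrReal μ f x - fnRearrReal μ f y)) ≤
      ENNReal.ofReal (K * (y - x)) := by
    refine (h.mul_sub_le hgrad hfl (ha.trans_le hx.1) hxy
      fun s hs => hmin ⟨hx.1.trans hs.1, hs.2.trans hy.2⟩).trans ?_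
    refine (lintegral_mono fun x => gradMod_le_of_lipschitz hf x).trans ?_
    rw [setLIntegral_const, ENNReal.ofReal_mul K.coe_nonneg, ENNReal.ofReal_coe_nnreal]
    exact mul_le_mul_right (measure_band_le μ hf.continuous.measurable.enorm
      (ha.le.trans hx.1) (hsub hx).2) _
  rw [ENNReal.ofReal_le_ofReal_iff (mul_nonneg K.coe_nonneg (sub_nonneg.2 hxy))] at h1
  rw [Real.dist_eq, abs_sub_comm, abs_of_nonneg (sub_nonneg.2 hxy), div_mul_eq_mul_div,
    ← sub_le_iff_le_add', le_div_iff₀ hm]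
  linarith

/-- For the test function, `f^*` drops from at least `1` to `0` across an interval around `μ(A)`
where `I ≥ C`. Hence `(-f^*)' I` has integral at least `C`, and the inequality at `t = 1` compares
this with the energy. The auxiliary `P` rules out jumps and singular parts of `f^*`, which the a.e.
derivative would miss. -/
theorem PolyaSzegoInequality.isoperimetric (hI : IsProfileShape I) (h : PolyaSzegoInequality μ I)
    (hgrad : GradVanishesOnLevels μ) {P : ℝ → ℝ} (hP : IsProfileShape P)
    (hPL : LedouxInequality μ P) : IsoperimetricInequality μ I := by
  refine hI.isoperimetricInequality_of_nontrivial fun A hAm hA hp => ?_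
  set p := (μ A).toReal with hpdef
  have hpA : ENNReal.ofReal p = μ A := ENNReal.ofReal_toReal (measure_ne_top _ _)
  have key : ∀ a b C, 0 < a → a < p → p < b → b < 1 → 0 ≤ C → (∀ s ∈ Icc a b, C ≤ I s) →
      ENNReal.ofReal C ≤ perimeter μ A := by
    intro a b C ha hap hpb hb hC hCI
    have hab : a ≤ b := (hap.trans hpb).le
    refine ofReal_le_perimeter hpb fun r hr hrt => ?_
    have hlip := lipschitzWith_bump A hr
    set F := fnRearrReal μ (bump A r) with hF
    have hFa : 1 ≤ F a := by
      have h1 : 1 ≤ fnRearr μ (bump A r) a := one_le_fnRearr_bump r (by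
        rw [← hpA]
        exact (ENNReal.ofReal_lt_ofReal_iff hp.1).2 hap)
      have h2 := ENNReal.toReal_mono (fnRearr_ne_top μ hlip.continuous.measurable ha) h1
      rwa [ENNReal.toReal_one] at h2
    have hFb : F b = 0 := by
      simp only [hF, fnRearrReal]
      rw [fnRearr_bump_eq_zero hA hr hrt, ENNReal.toReal_zero]
    obtain ⟨K, hK⟩ := hPL.lipschitzOnWith_fnRearrReal hP hgrad hlip ha hab hb
    -- Local Lipschitz continuity of `f^*` is what permits the fundamental theorem of calculus here.
    have hftc : ∫ x in a..b, deriv F x = F b - F a := by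
      refine AbsolutelyContinuousOnInterval.integral_deriv_eq_sub
        (LipschitzOnWith.absolutelyContinuousOnInterval (K := K) ?_)
      rwa [uIcc_of_le hab]
    calc ENNReal.ofReal C ≤ ‖∫ x in Ioc a b, C * deriv F x‖ₑ := by
          rw [integral_const_mul, ← intervalIntegral.integral_of_le hab, hftc, hFb, zero_sub,
            mul_neg, enorm_neg, Real.enorm_of_nonneg (mul_nonneg hC (zero_le_one.trans hFa))]
          exact ENNReal.ofReal_le_ofReal (le_mul_of_one_le_right hC hFa)
      _ ≤ ∫⁻ x in Ioc a b, ‖C * deriv F x‖ₑ := enorm_integral_le_lintegral_enorm _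
      _ ≤ ∫⁻ x in Ioc a b, ‖-deriv F x * I x‖ₑ := by
          refine setLIntegral_mono' measurableSet_Ioc fun x hx => ?_
          have hCx := hCI x ⟨hx.1.le, hx.2⟩
          rw [enorm_mul, enorm_mul, enorm_neg, mul_comm, Real.enorm_of_nonneg hC,
            Real.enorm_of_nonneg (hC.trans hCx)]
          exact mul_le_mul_right (ENNReal.ofReal_le_ofReal hCx) _
      _ ≤ ∫⁻ x in Ioo (0 : ℝ) 1, ‖-deriv F x * I x‖ₑ :=
          lintegral_mono_set fun x hx => ⟨ha.trans hx.1, hx.2.trans_lt hb⟩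
      _ = ∫⁻ s in Ioo (0 : ℝ) 1,
            rearr (volume.restrict (Ioo (0 : ℝ) 1)) (fun r => ‖-deriv F r * I r‖ₑ) s :=
          lintegral_comp_rearr _ (hI.aemeasurable_deriv_mul F) measurable_id
      _ ≤ ∫⁻ s in Ioo (0 : ℝ) 1, rearr μ (gradMod (bump A r)) s :=
          h _ (isLip_of_lipschitzWith hlip) 1 one_pos
      _ ≤ _ := (lintegral_rearr_le_lintegral μ
          (measurable_gradMod hlip.continuous).aemeasurable 1).trans
        (hgrad.lintegral_bump_le hAm hA hr)
  have hcont : ContinuousAt I p := hI.continuousOn.continuousAt (Icc_mem_nhds hp.1 hp.2)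
  have hlim : Tendsto (fun C => ENNReal.ofReal C) (𝓝[<] (I p)) (𝓝 (ENNReal.ofReal (I p))) :=
    ENNReal.tendsto_ofReal (tendsto_id.mono_left nhdsWithin_le_nhds)
  refine le_of_tendsto hlim ?_
  filter_upwards [Ioo_mem_nhdsLT (hI.pos p hp)] with C hC
  have hev : ∀ᶠ s in 𝓝 p, C ≤ I s ∧ s ∈ Ioo (0 : ℝ) 1 :=
    (hcont.eventually (lt_mem_nhds hC.2)).mono (fun _ => le_of_lt) |>.and
      (Ioo_mem_nhds hp.1 hp.2)
  obtain ⟨δ, hδ, hball⟩ := Metric.nhds_basis_closedBall.eventually_iff.1 hev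
  rw [Real.closedBall_eq_Icc] at hball
  exact key (p - δ) (p + δ) C (hball ⟨le_rfl, by linarith⟩).2.1 (by linarith) (by linarith)
    (hball ⟨by linarith, le_rfl⟩).2.2 hC.1.le fun s hs => (hball hs).1

/-- The profile is itself an admissible estimator; this supplies the function `P` needed to pass
from Pólya–Szegő to isoperimetry. -/
theorem HasConcaveProfile.ledoux (h : HasConcaveProfile μ) :
    LedouxInequality μ fun t => (profile μ t).toReal :=
  (isoperimetricInequality_of_le_profile fun _ _ => ENNReal.ofReal_toReal_le).ledoux h.shape

end IsoSymm

theorem mainTheorem1 {Ω : Type*} [MetricSpace Ω] [ConnectedSpace Ω] [MeasurableSpace Ω]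
    [BorelSpace Ω] (μ : Measure Ω) [IsProbabilityMeasure μ] [NullSingletonClass μ]
    (hsep : ∃ S : Set Ω, TopologicalSpace.IsSeparable S ∧ ∀ᵐ x ∂μ, x ∈ S)
    (hprofile : IsoSymm.HasConcaveProfile μ)
    (hgrad : IsoSymm.GradVanishesOnLevels μ)
    (I : ℝ → ℝ) (hI : IsoSymm.IsProfileShape I) :
    (IsoSymm.IsIsoperimetricEstimator μ I →
      IsoSymm.IsoperimetricInequality μ I ∧
      IsoSymm.LedouxInequality μ I ∧
      IsoSymm.MazyaInequality μ I ∧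
      IsoSymm.PolyaSzegoInequality μ I ∧
      IsoSymm.OscillationInequality μ I) ∧
    List.TFAE [
      IsoSymm.IsoperimetricInequality μ I,
      IsoSymm.LedouxInequality μ I,
      IsoSymm.MazyaInequality μ I,
      IsoSymm.PolyaSzegoInequality μ I,
      IsoSymm.OscillationInequality μ I] := by
  refine ⟨fun h => ?_, ?_⟩
  · have h1 := IsoSymm.isoperimetricInequality_of_le_profile h.le_profile
    have h2 := h1.ledoux hI
    have h3 := h2.mazya hI hgrad
    exact ⟨h1, h2, h3, h3.polyaSzego hI hgrad, h2.oscillation hI hgrad⟩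
  · tfae_have 1 → 2 := fun h => h.ledoux hI
    tfae_have 2 → 3 := fun h => h.mazya hI hgrad
    tfae_have 3 → 4 := fun h => h.polyaSzego hI hgrad
    tfae_have 4 → 1 := fun h => h.isoperimetric hI hgrad hprofile.shape hprofile.ledoux
    tfae_have 2 → 5 := fun h => h.oscillation hI hgrad
    tfae_have 5 → 1 := fun h => h.isoperimetric hI hgrad
    tfae_finish
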